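/- Let $n$ be a non-negative integer and let $\alpha,\beta$ be real numbers such that none of $\alpha,\beta,\alpha+\beta$ is an integer and $-n<\alpha+\beta+n<-1$. Let $$P_n^{(\alpha,\beta)}(z)=2^{-n}\sum_{k=0}^n\binom{n+\alpha}{n-k}\binom{n+\beta}{k}(z-1)^k(z+1)^{n-k}$$ be the Jacobi polynomial and $m=\lfloor-(n+\alpha+\beta+1)\rfloor$. Write $w(z;\alpha,\beta)=(1-z)^\alpha(1+z)^\beta$. Suppose that $\alpha>-1$ (resp. $\beta>-1$). Put $s=1$, $\Delta=[1,\infty)$ (resp. $s=-1$, $\Delta=(-\infty,-1]$), and let $\gamma$ be any rectifiable curve from $1-i0$ to $1+i0$ which, apart from its endpoints, lies in $\mathbb C\setminus[-1,\infty)$ (resp. from $-1+i0$ to $-1-i0$ in $\mathbb C\setminus(-\infty,1]$). Here $1\pm i0$ means that the curve leaves, respectively reaches, the point $1$ through the half-plane $\pm\operatorname{Im}z>0$, and similarly for $-1\pm i0$. On $\Delta\setminus\{s\}$ and on $\gamma\setminus\{s\}$ let $w$ denote any continuous branch of the weight. Integrals along $\gamma$, whose integrand may be singular at the endpoint $s$,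 are understood as limits of the integrals over the compact sub-arcs of $\gamma$ not containing the endpoints. Consider for a polynomial $p$ with complex coefficients the conditions 1. $\displaystyle\int_\Delta q(t)\,p(t)\,w(t;\alpha,\beta)\,dt=0$, with an absolutely convergent integral, for every complex polynomial $q$ of degree at most $m$; 2. $\displaystyle\int_\gamma t^k\,p(t)\,w(t;\alpha,\beta)\,dt$ exists and equals $0$ for all integers $k$ with $m+1\le k\le n-1$; 3. $\displaystyle\int_\gamma t^n\,p(t)\,w(t;\alpha,\beta)\,dt$ exists and is nonzero. Then $P_n^{(\alpha,\beta)}$ has degree exactly $n$ and satisfies conditions 1, 2 and 3. Moreover, a polynomial $p$ of degree at most $n$ satisfies conditions 1, 2 and 3 if and only if $p=c\,P_n^{(\alpha,\beta)}$ for some constant $c\ne0$. -/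

import Mathlib

open Filter Topology MeasureTheory Polynomial

namespace JacobiOrth

noncomputable section

/-- The Jacobi polynomial with arbitrary complex parameters,
`2⁻ⁿ ∑ₖ binom(n+α, n-k) binom(n+β, k) (z-1)ᵏ (z+1)ⁿ⁻ᵏ`, where `Ring.choose` is the
generalized binomial coefficient. -/
def jacobi (n : ℕ) (α β : ℂ) : ℂ[X] :=
  C ((2 : ℂ)⁻¹ ^ n) * ∑ k ∈ Finset.range (n + 1),
    C (Ring.choose ((n : ℂ) + α) (n - k) * Ring.choose ((n : ℂ) + β) k) *
      ((X - 1) ^ k * (X + 1) ^ (n - k))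

/-- `W` is, on the set `S`, a continuous branch of the multivalued function
`w(z; α, β) = (1-z)^α (z+1)^β = exp (α log (1-z) + β log (z+1))`: each value on `S` is given by
some choice `a`, `b` of the two logarithms, and `W` is continuous on `S`. -/
def IsWeightBranch (α β : ℝ) (S : Set ℂ) (W : ℂ → ℂ) : Prop :=
  ContinuousOn W S ∧
    ∀ z ∈ S, ∃ a b : ℂ, Complex.exp a = 1 - z ∧ Complex.exp b = z + 1 ∧
      W z = Complex.exp (α * a + β * b)

/-- `γ`, restricted to `[0, 1]`, is an absolutely continuous (hence rectifiable) parametrization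
of a curve going from `1 - i0` to `1 + i0` which, except for its endpoints, lies in
`ℂ \ [-1, ∞)`. (Such a curve goes around `-1` clockwise.) -/
structure IsCurveOne (γ : ℝ → ℂ) : Prop where
  absCont : AbsolutelyContinuousOnInterval γ 0 1
  source : γ 0 = 1
  target : γ 1 = 1
  avoids : ∀ t ∈ Set.Ioo (0 : ℝ) 1, γ t ∉ Complex.ofReal '' Set.Ici (-1)
  starts_below : ∀ᶠ t in 𝓝[>] (0 : ℝ), (γ t).im < 0
  ends_above : ∀ᶠ t in 𝓝[<] (1 : ℝ), 0 < (γ t).im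

/-- `γ`, restricted to `[0, 1]`, is an absolutely continuous (hence rectifiable) parametrization
of a curve going from `-1 + i0` to `-1 - i0` which, except for its endpoints, lies in
`ℂ \ (-∞, 1]`. (Such a curve goes around `1` clockwise.) -/
structure IsCurveNegOne (γ : ℝ → ℂ) : Prop where
  absCont : AbsolutelyContinuousOnInterval γ 0 1
  source : γ 0 = -1
  target : γ 1 = -1
  avoids : ∀ t ∈ Set.Ioo (0 : ℝ) 1, γ t ∉ Complex.ofReal '' Set.Iic 1
  starts_above : ∀ᶠ t in 𝓝[>] (0 : ℝ), 0 < (γ t).im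
  ends_below : ∀ᶠ t in 𝓝[<] (1 : ℝ), (γ t).im < 0

/-- The contour integral `∫_γ f(z) dz` over the curve `γ|_{(0,1)}` exists and has the value `I`.
As `f` may be singular at the endpoints of the curve (and along an arbitrary rectifiable curve
the singularity need not be absolutely integrable), `f` has to be integrable along every
compact piece `γ|_{[a,b]}`, `0 < a < b < 1`, and the value is the limit for `a → 0`, `b → 1`.
If `f(γ(t)) γ'(t)` is Lebesgue integrable over `(0,1)`, then `I` is its Lebesgue integral. -/
def HasContourIntegral (f : ℂ → ℂ) (γ : ℝ → ℂ) (I : ℂ) : Prop :=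
  (∀ a b : ℝ, 0 < a → a < b → b < 1 →
    IntervalIntegrable (fun t => f (γ t) * deriv γ t) volume a b) ∧
  Tendsto (fun p : ℝ × ℝ => ∫ t in p.1..p.2, f (γ t) * deriv γ t)
    (𝓝[>] (0 : ℝ) ×ˢ 𝓝[<] (1 : ℝ)) (𝓝 I)

/-- The multiple orthogonality conditions on a polynomial `p`: with weight `V` on the real
interval `Δ`, orthogonality to all polynomials of degree `≤ m` (with absolutely convergent
integrals); with weight `W` on the curve `γ`, orthogonality to `t ^ k` for `m + 1 ≤ k ≤ n - 1`,
while the integral against `t ^ n` exists and does not vanish. -/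
structure MultipleOrthogonal (n : ℕ) (m : ℤ) (Δ : Set ℝ) (V : ℂ → ℂ) (γ : ℝ → ℂ) (W : ℂ → ℂ)
    (p : ℂ[X]) : Prop where
  real_line : ∀ q : ℂ[X], (q.natDegree : ℤ) ≤ m →
    IntegrableOn (fun x : ℝ => q.eval (x : ℂ) * p.eval (x : ℂ) * V x) Δ ∧
      ∫ x in Δ, q.eval (x : ℂ) * p.eval (x : ℂ) * V x = 0
  curve : ∀ k : ℕ, m + 1 ≤ (k : ℤ) → (k : ℤ) ≤ (n : ℤ) - 1 →
    HasContourIntegral (fun z => z ^ k * p.eval z * W z) γ 0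
  curve_ne : ∃ I : ℂ, I ≠ 0 ∧ HasContourIntegral (fun z => z ^ n * p.eval z * W z) γ I

end

end JacobiOrth

/-! On the curve at `1`, the Jacobi polynomial is orthogonal to every power below `n`, with no
restriction on `α + β` beyond non-integrality. By the raising relation `jacobi_succ`, `P_n w` is, up
to a constant, the derivative of `(1 - z²) w P_{n-1}^{(α+1,β+1)}`. The boundary terms vanish at `1`
because `α > -1`. Integrating `q P_n w` by parts `n` times therefore leaves the coefficient of `z ^
n` in `q` times a nonzero multiple of the total mass of the weight with exponents `α + n`, `β + n`
(`IsCurveOne.exists_hasContourIntegral_jacobi`).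

That mass is nonzero. If `a + b < -1`, the curve can be collapsed onto the two sides of `(1, ∞)`,
which gives `2i sin (π (a + b))` times a positive real integral. The remaining exponents are reached
by a recursion in `b` whose factors vanish or blow up only at integers. Instead of deforming the
curve, the proof uses an explicit primitive on the cut plane, integrated along rays from infinity:
the contour integral is then the difference of its two boundary values at `1`, for any rectifiable
curve.

The same collapse applies to `q p w` when `deg q ≤ m` and `deg p ≤ n`, since `α + β + n + m < -1`.
Integrals over `Δ` and over the curve then differ by a nonzero factor, so conditions 1 and 2
together say that `p` is orthogonal on the curve to all powers below `n`. Uniqueness follows by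
pairing a remainder of degree `d < n` with the Jacobi polynomial of degree `d`
(`IsCurveOne.eq_C_mul_jacobi`). The case at `-1` is the image of the case at `1` under `z ↦ -z`. -/

namespace JacobiOrth

/-! ### Primitives along absolutely continuous curves -/

/-- The fundamental theorem of calculus for absolutely continuous complex-valued functions. -/
theorem intervalIntegrable_deriv_and_integral_eq {h : ℝ → ℂ} {a b : ℝ}
    (hh : AbsolutelyContinuousOnInterval h a b) :
    IntervalIntegrable (deriv h) volume a b ∧ ∫ t in a..b, deriv h t = h b - h a := by
  have hre : AbsolutelyContinuousOnInterval (fun t => (h t).re) a b := by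
    refine squeeze_zero (fun t => Finset.sum_nonneg fun i _ => dist_nonneg) (fun t => ?_) hh
    gcongr
    rw [Real.dist_eq, dist_eq_norm, ← Complex.sub_re]
    exact Complex.abs_re_le_norm _
  have him : AbsolutelyContinuousOnInterval (fun t => (h t).im) a b := by
    refine squeeze_zero (fun t => Finset.sum_nonneg fun i _ => dist_nonneg) (fun t => ?_) hh
    gcongr
    rw [Real.dist_eq, dist_eq_norm, ← Complex.sub_im]
    exact Complex.abs_im_le_norm _
  have hae : ∀ᵐ t, t ∈ Set.uIoc a b →
      deriv h t = ((deriv (fun t => (h t).re) t : ℝ) : ℂ) +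
        ((deriv (fun t => (h t).im) t : ℝ) : ℂ) * Complex.I := by
    filter_upwards [hh.boundedVariationOn.ae_differentiableAt_of_mem_uIcc] with t ht hmem
    have hd := (ht (Set.uIoc_subset_uIcc hmem)).hasDerivAt
    have h1 : HasDerivAt (fun t => (h t).re) (deriv h t).re t :=
      (Complex.reCLM.hasFDerivAt.comp_hasDerivAt t hd)
    have h2 : HasDerivAt (fun t => (h t).im) (deriv h t).im t :=
      (Complex.imCLM.hasFDerivAt.comp_hasDerivAt t hd)
    rw [h1.deriv, h2.deriv, Complex.re_add_im]
  have i1 : IntervalIntegrable (fun t => ((deriv (fun t => (h t).re) t : ℝ) : ℂ)) volume a b :=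
    ⟨hre.intervalIntegrable_deriv.1.ofReal, hre.intervalIntegrable_deriv.2.ofReal⟩
  have i2 : IntervalIntegrable (fun t => ((deriv (fun t => (h t).im) t : ℝ) : ℂ) * Complex.I)
      volume a b := IntervalIntegrable.mul_const
    ⟨him.intervalIntegrable_deriv.1.ofReal, him.intervalIntegrable_deriv.2.ofReal⟩ _
  refine ⟨(i1.add i2).congr_ae ?_, ?_⟩
  · rw [EventuallyEq, ae_restrict_iff' measurableSet_uIoc]
    filter_upwards [hae] with t ht hmem using (ht hmem).symm
  · rw [intervalIntegral.integral_congr_ae hae, intervalIntegral.integral_add i1 i2,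
      intervalIntegral.integral_mul_const]
    have e1 := hre.integral_deriv_eq_sub
    have e2 := him.integral_deriv_eq_sub
    have e1' : ∫ t in a..b, ((deriv (fun t => (h t).re) t : ℝ) : ℂ) = _ :=
      intervalIntegral.integral_ofReal
    have e2' : ∫ t in a..b, ((deriv (fun t => (h t).im) t : ℝ) : ℂ) = _ :=
      intervalIntegral.integral_ofReal
    rw [e1', e2', e1, e2]
    apply Complex.ext <;> simp

/-- A holomorphic function composed with an absolutely continuous curve is absolutely
continuous. -/
theorem absolutelyContinuousOnInterval_comp {U : Set ℂ} (hU : IsOpen U) {F f : ℂ → ℂ}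
    (hF : ∀ z ∈ U, HasDerivAt F (f z) z) {γ : ℝ → ℂ} {a b : ℝ}
    (hγ : AbsolutelyContinuousOnInterval γ a b) (hmem : ∀ t ∈ Set.uIcc a b, γ t ∈ U) :
    AbsolutelyContinuousOnInterval (fun t => F (γ t)) a b := by
  have hdiff : DifferentiableOn ℂ F U := fun z hz => (hF z hz).differentiableAt.differentiableWithinAt
  have hK : IsCompact (γ '' Set.uIcc a b) := isCompact_uIcc.image_of_continuousOn hγ.continuousOn
  have hKU : γ '' Set.uIcc a b ⊆ U := by
    rintro _ ⟨t, ht, rfl⟩; exact hmem t ht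
  -- Holomorphic functions are locally Lipschitz, and compactness of the image of the curve yields a
  -- single constant.
  have hlip : LocallyLipschitzOn (γ '' Set.uIcc a b) F := by
    intro z hz
    have han := (hdiff.analyticAt (hU.mem_nhds (hKU hz)))
    obtain ⟨K, s, hs, hL⟩ := han.hasStrictFDerivAt.exists_lipschitzOnWith
    exact ⟨K, s, mem_nhdsWithin_of_mem_nhds hs, hL⟩
  obtain ⟨K, hL⟩ := hlip.exists_lipschitzOnWith_of_compact hK
  rw [absolutelyContinuousOnInterval_iff] at hγ ⊢
  intro ε hε
  -- The divisor `K + 1` rather than `K` allows for a vanishing Lipschitz constant.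
  obtain ⟨δ, hδ, H⟩ := hγ (ε / (K + 1)) (by positivity)
  refine ⟨δ, hδ, fun E hE hEδ => ?_⟩
  have h1 := H E hE hEδ
  rw [lt_div_iff₀ (by positivity)] at h1
  refine lt_of_le_of_lt ?_ h1
  rw [Finset.sum_mul]
  refine Finset.sum_le_sum fun i hi => ?_
  have hi' := hE.1 i hi
  refine (hL.dist_le_mul _ (Set.mem_image_of_mem _ hi'.1) _
    (Set.mem_image_of_mem _ hi'.2)).trans ?_
  rw [mul_comm]
  gcongr
  linarith

/-- The contour integral of a function with a primitive is the difference of the boundary values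
of the primitive. -/
theorem hasContourIntegral_of_hasDerivAt {U : Set ℂ} (hU : IsOpen U) {F f : ℂ → ℂ}
    (hF : ∀ z ∈ U, HasDerivAt F (f z) z) {γ : ℝ → ℂ}
    (hγ : AbsolutelyContinuousOnInterval γ 0 1) (hmem : ∀ t ∈ Set.Ioo (0 : ℝ) 1, γ t ∈ U)
    {L₀ L₁ : ℂ} (h0 : Tendsto (fun t => F (γ t)) (𝓝[>] 0) (𝓝 L₀))
    (h1 : Tendsto (fun t => F (γ t)) (𝓝[<] 1) (𝓝 L₁)) :
    HasContourIntegral f γ (L₁ - L₀) := by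
  have key : ∀ a b : ℝ, 0 < a → a < b → b < 1 →
      IntervalIntegrable (fun t => f (γ t) * deriv γ t) volume a b ∧
      ∫ t in a..b, f (γ t) * deriv γ t = F (γ b) - F (γ a) := by
    intro a b ha hab hb
    have hsub : ∀ t ∈ Set.uIcc a b, t ∈ Set.Ioo (0 : ℝ) 1 := by
      intro t ht
      rw [Set.uIcc_of_le hab.le] at ht
      exact ⟨ha.trans_le ht.1, ht.2.trans_lt hb⟩
    have hγ' : AbsolutelyContinuousOnInterval γ a b := hγ.mono fun t ht => by
      rw [Set.uIcc_of_le zero_le_one]; exact Set.Ioo_subset_Icc_self (hsub t ht)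
    have hac := absolutelyContinuousOnInterval_comp hU hF hγ' fun t ht => hmem t (hsub t ht)
    obtain ⟨i, e⟩ := intervalIntegrable_deriv_and_integral_eq hac
    have hae : ∀ᵐ t, t ∈ Set.uIoc a b →
        deriv (fun t => F (γ t)) t = f (γ t) * deriv γ t := by
      filter_upwards [hγ'.boundedVariationOn.ae_differentiableAt_of_mem_uIcc] with t ht hmem'
      have hd := (ht (Set.uIoc_subset_uIcc hmem')).hasDerivAt
      exact ((hF _ (hmem t (hsub t (Set.uIoc_subset_uIcc hmem')))).comp t hd).deriv
    refine ⟨i.congr_ae ?_, ?_⟩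
    · rw [EventuallyEq, ae_restrict_iff' measurableSet_uIoc]
      exact hae
    · rw [← intervalIntegral.integral_congr_ae hae, e]
  refine ⟨fun a b ha hab hb => (key a b ha hab hb).1, ?_⟩
  have hlim : Tendsto (fun p : ℝ × ℝ => F (γ p.2) - F (γ p.1))
      (𝓝[>] (0 : ℝ) ×ˢ 𝓝[<] (1 : ℝ)) (𝓝 (L₁ - L₀)) :=
    (h1.comp tendsto_snd).sub (h0.comp tendsto_fst)
  refine hlim.congr' ?_
  -- Separating the two endpoints at `1 / 2` guarantees `p.1 < p.2`.
  have ha : ∀ᶠ x in 𝓝[>] (0 : ℝ), x ∈ Set.Ioo (0 : ℝ) (1 / 2) :=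
    Ioo_mem_nhdsGT (by norm_num)
  have hb : ∀ᶠ x in 𝓝[<] (1 : ℝ), x ∈ Set.Ioo (1 / 2 : ℝ) 1 :=
    Ioo_mem_nhdsLT (by norm_num)
  filter_upwards [ha.prod_mk hb] with p hp
  exact (key p.1 p.2 hp.1.1 (hp.1.2.trans hp.2.1) hp.2.2).2.symm

/-! ### Linearity and congruence of contour integrals -/

namespace HasContourIntegral

variable {f g : ℂ → ℂ} {γ : ℝ → ℂ} {I J : ℂ}

theorem unique (hI : HasContourIntegral f γ I) (hJ : HasContourIntegral f γ J) : I = J :=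
  tendsto_nhds_unique hI.2 hJ.2

/-- Comparing the products with `deriv γ`, rather than `f` alone, lets the curve itself change, as
the reflection in the origin requires. -/
theorem congr_integrand (hI : HasContourIntegral f γ I) {F : ℝ → ℂ}
    (hfg : ∀ t ∈ Set.Ioo (0 : ℝ) 1, f (γ t) * deriv γ t = F t) :
    (∀ a b : ℝ, 0 < a → a < b → b < 1 → IntervalIntegrable F volume a b) ∧
    Tendsto (fun p : ℝ × ℝ => ∫ t in p.1..p.2, F t) (𝓝[>] (0 : ℝ) ×ˢ 𝓝[<] (1 : ℝ)) (𝓝 I) := by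
  have hsub : ∀ a b : ℝ, 0 < a → a < b → b < 1 → ∀ t ∈ Set.uIcc a b,
      f (γ t) * deriv γ t = F t := by
    intro a b ha hab hb t ht
    rw [Set.uIcc_of_le hab.le] at ht
    exact hfg t ⟨ha.trans_le ht.1, ht.2.trans_lt hb⟩
  refine ⟨fun a b ha hab hb => (hI.1 a b ha hab hb).congr
    fun t ht => hsub a b ha hab hb t (Set.uIoc_subset_uIcc ht), ?_⟩
  refine hI.2.congr' ?_
  have ha : ∀ᶠ x in 𝓝[>] (0 : ℝ), x ∈ Set.Ioo (0 : ℝ) (1 / 2) :=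
    Ioo_mem_nhdsGT (by norm_num)
  have hb : ∀ᶠ x in 𝓝[<] (1 : ℝ), x ∈ Set.Ioo (1 / 2 : ℝ) 1 :=
    Ioo_mem_nhdsLT (by norm_num)
  filter_upwards [ha.prod_mk hb] with p hp
  exact intervalIntegral.integral_congr (hsub p.1 p.2 hp.1.1 (hp.1.2.trans hp.2.1) hp.2.2)

theorem congr (hI : HasContourIntegral f γ I)
    (hfg : ∀ t ∈ Set.Ioo (0 : ℝ) 1, f (γ t) = g (γ t)) : HasContourIntegral g γ I :=
  hI.congr_integrand fun t ht => by rw [hfg t ht]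

theorem const_mul (hI : HasContourIntegral f γ I) (c : ℂ) :
    HasContourIntegral (fun z => c * f z) γ (c * I) := by
  refine ⟨fun a b ha hab hb => ?_, ?_⟩
  · simpa only [mul_assoc] using (hI.1 a b ha hab hb).const_mul c
  · simpa only [mul_assoc, intervalIntegral.integral_const_mul] using hI.2.const_mul c

theorem add (hI : HasContourIntegral f γ I) (hJ : HasContourIntegral g γ J) :
    HasContourIntegral (fun z => f z + g z) γ (I + J) := by
  refine ⟨fun a b ha hab hb => ?_, ?_⟩
  · simpa only [add_mul] using (hI.1 a b ha hab hb).add (hJ.1 a b ha hab hb)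
  · refine (hI.2.add hJ.2).congr' ?_
    have ha : ∀ᶠ x in 𝓝[>] (0 : ℝ), x ∈ Set.Ioo (0 : ℝ) (1 / 2) :=
      Ioo_mem_nhdsGT (by norm_num)
    have hb : ∀ᶠ x in 𝓝[<] (1 : ℝ), x ∈ Set.Ioo (1 / 2 : ℝ) 1 :=
      Ioo_mem_nhdsLT (by norm_num)
    filter_upwards [ha.prod_mk hb] with p hp
    have hp' : 0 < p.1 ∧ p.1 < p.2 ∧ p.2 < 1 := ⟨hp.1.1, hp.1.2.trans hp.2.1, hp.2.2⟩
    simp only [add_mul]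
    rw [intervalIntegral.integral_add (hI.1 _ _ hp'.1 hp'.2.1 hp'.2.2)
      (hJ.1 _ _ hp'.1 hp'.2.1 hp'.2.2)]

theorem zero : HasContourIntegral (fun _ => 0) γ 0 := by
  refine ⟨fun a b _ _ _ => ?_, ?_⟩
  · simp
  · simp

theorem sum {ι : Type*} (s : Finset ι) {f : ι → ℂ → ℂ} {I : ι → ℂ}
    (h : ∀ i ∈ s, HasContourIntegral (f i) γ (I i)) :
    HasContourIntegral (fun z => ∑ i ∈ s, f i z) γ (∑ i ∈ s, I i) := by
  classical
  induction s using Finset.induction_on with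
  | empty => simpa using zero
  | insert i s hi ih =>
    simp only [Finset.sum_insert hi]
    exact (h i (by simp)).add (ih fun j hj => h j (by simp [hj]))

/-- Reflecting the plane in the origin. -/
theorem comp_neg (hI : HasContourIntegral f γ I) :
    HasContourIntegral (fun z => f (-z)) (fun t => -γ t) (-I) := by
  have h := (hI.const_mul (-1)).congr_integrand
    (F := fun t => f (-(-γ t)) * deriv (fun t => -γ t) t) fun t _ => by
      rw [deriv.fun_neg, neg_neg]; ring
  rw [neg_one_mul] at h
  exact h

end HasContourIntegral

/-! ### The weight on the cut plane and its recursions -/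

noncomputable section

/-- The plane cut along `[-1, ∞)`. -/
def cutPlane : Set ℂ := {z | -(1 + z) ∈ Complex.slitPlane}

theorem isOpen_cutPlane : IsOpen cutPlane :=
  Complex.isOpen_slitPlane.preimage (by fun_prop)

theorem mem_cutPlane_iff {z : ℂ} : z ∈ cutPlane ↔ z ∉ Complex.ofReal '' Set.Ici (-1) := by
  simp only [cutPlane, Set.mem_ofPred_eq, Complex.mem_slitPlane_iff, Set.mem_image, Set.mem_Ici,
    not_exists, not_and, Complex.neg_re, Complex.add_re, Complex.one_re, Complex.neg_im,
    Complex.add_im, Complex.one_im, zero_add, neg_ne_zero]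
  constructor
  · rintro h x hx rfl
    simp only [Complex.ofReal_re, Complex.ofReal_im] at h
    rcases h with h | h
    · linarith
    · exact h rfl
  · intro h
    by_contra! hc
    exact h z.re (by linarith [hc.1]) (Complex.ext (by simp) (by simp [hc.2]))

/-- Positive scaling and translation to the right preserve the slit plane. This keeps `1 - z` and `2
- r ζ` in the domain of the principal branch. -/
theorem add_mem_slitPlane {z : ℂ} (hz : z ∈ Complex.slitPlane) {x r : ℝ} (hx : 0 ≤ x) (hr : 0 < r) :
    (x : ℂ) + r * z ∈ Complex.slitPlane := by
  rw [Complex.mem_slitPlane_iff] at hz ⊢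
  simp only [Complex.add_re, Complex.ofReal_re, Complex.mul_re, Complex.ofReal_im, zero_mul,
    sub_zero, Complex.add_im, Complex.mul_im, zero_add, add_zero]
  rcases hz with h | h
  · left; positivity
  · right; exact mul_ne_zero hr.ne' h

theorem one_sub_mem_slitPlane {z : ℂ} (hz : z ∈ cutPlane) : 1 - z ∈ Complex.slitPlane := by
  have := add_mem_slitPlane hz (x := 2) (r := 1) (by norm_num) one_pos
  convert this using 1
  push_cast
  ring

/-- The branch `(1 - z) ^ a * (-(1 + z)) ^ b` of the weight, up to a constant factor, in the plane
cut along `[-1, ∞)`. -/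
def cutWeight (a b : ℝ) (z : ℂ) : ℂ := (1 - z) ^ (a : ℂ) * (-(1 + z)) ^ (b : ℂ)

theorem cutWeight_add_one_left (a b : ℝ) {z : ℂ} (hz : z ∈ cutPlane) :
    cutWeight (a + 1) b z = (1 - z) * cutWeight a b z := by
  have := Complex.slitPlane_ne_zero (one_sub_mem_slitPlane hz)
  simp only [cutWeight]
  push_cast
  rw [Complex.cpow_add _ _ this, Complex.cpow_one]
  ring

theorem cutWeight_add_one_right (a b : ℝ) {z : ℂ} (hz : z ∈ cutPlane) :
    cutWeight a (b + 1) z = -(1 + z) * cutWeight a b z := by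
  have := Complex.slitPlane_ne_zero hz
  simp only [cutWeight]
  push_cast
  rw [Complex.cpow_add _ _ this, Complex.cpow_one]
  ring

theorem hasDerivAt_cutWeight (a b : ℝ) {z : ℂ} (hz : z ∈ cutPlane) :
    HasDerivAt (cutWeight (a + 1) (b + 1))
      (-(a + 1) * cutWeight a (b + 1) z - (b + 1) * cutWeight (a + 1) b z) z := by
  have h1 : HasDerivAt (fun z : ℂ => 1 - z) (-1) z := by
    simpa using (hasDerivAt_id z).const_sub 1
  have h2 : HasDerivAt (fun z : ℂ => -(1 + z)) (-1) z := by
    exact ((hasDerivAt_id z).const_add 1).neg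
  have := (h1.cpow_const (c := ((a + 1 : ℝ) : ℂ)) (one_sub_mem_slitPlane hz)).mul
    (h2.cpow_const (c := ((b + 1 : ℝ) : ℂ)) hz)
  convert! this using 1
  simp only [cutWeight]
  push_cast
  rw [add_sub_cancel_right, add_sub_cancel_right]
  ring

theorem continuousOn_cutWeight (a b : ℝ) : ContinuousOn (cutWeight a b) cutPlane := by
  intro z hz
  have := (hasDerivAt_cutWeight (a - 1) (b - 1) hz).continuousAt.continuousWithinAt (s := cutPlane)
  simpa using this

/-- Only norms matter, so the cut through `1` does no harm. -/
theorem tendsto_cutWeight_nhds_one {a : ℝ} (ha : 0 < a) (b : ℝ) :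
    Tendsto (cutWeight a b) (𝓝 1) (𝓝 0) := by
  rw [tendsto_zero_iff_norm_tendsto_zero]
  simp only [cutWeight, norm_mul, Complex.norm_cpow_real]
  have : ContinuousAt (fun z : ℂ => ‖1 - z‖ ^ a * ‖-(1 + z)‖ ^ b) 1 := by
    refine ContinuousAt.mul (ContinuousAt.rpow_const (by fun_prop) (Or.inr ha.le))
      (ContinuousAt.rpow_const (by fun_prop) (Or.inl ?_))
    norm_num
  have h := this.tendsto
  simpa [Real.zero_rpow ha.ne'] using h

theorem IsCurveOne.mem_cutPlane {γ : ℝ → ℂ} (hγ : IsCurveOne γ) {t : ℝ}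
    (ht : t ∈ Set.Ioo (0 : ℝ) 1) : γ t ∈ cutPlane :=
  mem_cutPlane_iff.2 (hγ.avoids t ht)

theorem IsCurveOne.tendsto_zero {γ : ℝ → ℂ} (hγ : IsCurveOne γ) :
    Tendsto γ (𝓝[>] 0) (𝓝 1) := by
  have h := hγ.absCont.continuousOn 0 (by simp)
  rw [Set.uIcc_of_le zero_le_one] at h
  have h' := (h.mono Set.Ioo_subset_Icc_self).tendsto
  rwa [nhdsWithin_Ioo_eq_nhdsGT zero_lt_one, hγ.source] at h'

theorem IsCurveOne.tendsto_one {γ : ℝ → ℂ} (hγ : IsCurveOne γ) :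
    Tendsto γ (𝓝[<] 1) (𝓝 1) := by
  have h := hγ.absCont.continuousOn 1 (by simp)
  rw [Set.uIcc_of_le zero_le_one] at h
  have h' := (h.mono Set.Ioo_subset_Icc_self).tendsto
  rwa [nhdsWithin_Ioo_eq_nhdsLT zero_lt_one, hγ.target] at h'

/-- The derivative of `(1 - z²) w q` integrates to zero along the curve. -/
theorem IsCurveOne.hasContourIntegral_deriv_cutWeight_mul {γ : ℝ → ℂ} (hγ : IsCurveOne γ) {a : ℝ}
    (ha : -1 < a) (b : ℝ) (q : ℂ[X]) :
    HasContourIntegral (fun z => (-(a + 1) * cutWeight a (b + 1) z -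
      (b + 1) * cutWeight (a + 1) b z) * q.eval z +
      cutWeight (a + 1) (b + 1) z * (derivative q).eval z) γ 0 := by
  have hlim : Tendsto (fun z => cutWeight (a + 1) (b + 1) z * q.eval z) (𝓝 1) (𝓝 0) := by
    simpa using (tendsto_cutWeight_nhds_one (by linarith) (b + 1)).mul q.continuous.continuousAt
  have := hasContourIntegral_of_hasDerivAt isOpen_cutPlane
    (fun z hz => (hasDerivAt_cutWeight a b hz).mul (q.hasDerivAt z)) hγ.absCont
    (fun t ht => hγ.mem_cutPlane ht) (hlim.comp hγ.tendsto_zero) (hlim.comp hγ.tendsto_one)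
  simpa using this

section Recursion

variable {γ : ℝ → ℂ} {a b : ℝ} {I : ℂ}

/-- The derivative of `cutWeight (a + 1) (b + 1)` integrates to zero. Writing `1 - z = 2 - (1 + z)`
expresses it through `cutWeight a b` and `cutWeight a (b + 1)` only. -/
theorem IsCurveOne.hasContourIntegral_raise_right (hγ : IsCurveOne γ) (ha : -1 < a)
    (hab : a + b + 2 ≠ 0) (hI : HasContourIntegral (cutWeight a b) γ I) :
    HasContourIntegral (cutWeight a (b + 1)) γ (-(2 * (b + 1)) / (a + b + 2) * I) := by
  have hab' : (a + b + 2 : ℂ) ≠ 0 := by exact_mod_cast hab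
  have h := ((hγ.hasContourIntegral_deriv_cutWeight_mul ha b 1).add
    (hI.const_mul (2 * (b + 1)))).const_mul (-1 / (a + b + 2))
  convert! h.congr (g := cutWeight a (b + 1)) fun t ht => ?_ using 1
  · field_simp
    ring
  · have hz := hγ.mem_cutPlane ht
    simp only [eval_one, derivative_one, eval_zero]
    rw [cutWeight_add_one_left a b hz, cutWeight_add_one_right a b hz]
    field_simp
    ring

/-- Integrating the derivative of `cutWeight (a + 1) b` trades a larger exponent at `1` for a
smaller one at `-1`, with `a + b` and hence the decay at infinity unchanged. -/
theorem IsCurveOne.hasContourIntegral_shift (hγ : IsCurveOne γ) (ha : -1 < a)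
    (hI : HasContourIntegral (cutWeight (a + 1) (b - 1)) γ I) :
    HasContourIntegral (cutWeight a b) γ (-b / (a + 1) * I) := by
  have ha' : (a + 1 : ℂ) ≠ 0 := by exact_mod_cast (by linarith : a + 1 ≠ 0)
  have h := ((hγ.hasContourIntegral_deriv_cutWeight_mul ha (b - 1) 1).add
    (hI.const_mul b)).const_mul (-1 / (a + 1))
  convert! h.congr (g := cutWeight a b) fun t ht => ?_ using 1
  · field_simp
    ring
  · simp only [eval_one, derivative_one, eval_zero, sub_add_cancel]
    push_cast
    field_simp
    ring

end Recursion

end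

/-! ### The real weight on `(1, ∞)` and one-sided boundary values of powers -/

noncomputable section

/-- The real weight `(t - 1) ^ a * (t + 1) ^ b` on `(1, ∞)`. -/
def realWeight (a b t : ℝ) : ℝ := (t - 1) ^ a * (t + 1) ^ b

theorem realWeight_pos (a b : ℝ) {t : ℝ} (ht : 1 < t) : 0 < realWeight a b t :=
  mul_pos (Real.rpow_pos_of_pos (by linarith) _) (Real.rpow_pos_of_pos (by linarith) _)

theorem realWeight_add_one_right (a b : ℝ) {t : ℝ} (ht : 1 < t) :
    realWeight a (b + 1) t = (t + 1) * realWeight a b t := by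
  rw [realWeight, realWeight, Real.rpow_add_one (by linarith)]
  ring

theorem integrableOn_realWeight {a b : ℝ} (ha : -1 < a) (hab : a + b < -1) :
    IntegrableOn (realWeight a b) (Set.Ioi 1) := by
  have hcont : ContinuousOn (realWeight a b) (Set.Ioi 1) := by
    intro t ht
    have ht : 1 < t := ht
    refine ContinuousAt.continuousWithinAt (ContinuousAt.mul ?_ ?_)
    · exact ContinuousAt.rpow_const (by fun_prop) (Or.inl (by linarith))
    · exact ContinuousAt.rpow_const (by fun_prop) (Or.inl (by linarith))
  have hmeas : AEStronglyMeasurable (realWeight a b) (volume.restrict (Set.Ioi 1)) :=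
    hcont.aestronglyMeasurable measurableSet_Ioi
  rw [← Set.Ioc_union_Ioi_eq_Ioi (show (1 : ℝ) ≤ 2 by norm_num), integrableOn_union]
  constructor
  · have h1 : IntegrableOn (fun t : ℝ => (t - 1) ^ a) (Set.Ioc 1 2) := by
      have := (intervalIntegral.intervalIntegrable_rpow' (a := 0) (b := 1) ha).comp_sub_right 1
      rw [intervalIntegrable_iff_integrableOn_Ioc_of_le (by norm_num)] at this
      norm_num at this
      exact this
    have h2 : IntegrableOn (fun t : ℝ => (t - 1) ^ a * (t + 1) ^ b) (Set.Icc 1 2) := by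
      refine (IntegrableOn.mul_continuousOn (by rwa [integrableOn_Icc_iff_integrableOn_Ioc]) ?_
        isCompact_Icc)
      intro t ht
      exact (ContinuousAt.rpow_const (by fun_prop)
        (Or.inl (by linarith [ht.1]))).continuousWithinAt
    exact h2.mono_set Set.Ioc_subset_Icc_self
  · have h1 : IntegrableOn (fun t : ℝ => (t + (-1)) ^ (a + b)) (Set.Ioi 2) :=
      integrableOn_add_rpow_Ioi_of_lt hab (by norm_num)
    refine (h1.const_mul (3 ^ |b|)).mono' (hmeas.mono_set (Set.Ioi_subset_Ioi (by norm_num))) ?_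
    rw [ae_restrict_iff' measurableSet_Ioi]
    refine Eventually.of_forall fun t ht => ?_
    have ht : 2 < t := ht
    rw [Real.norm_of_nonneg (realWeight_pos _ _ (by linarith)).le, realWeight, ← sub_eq_add_neg,
      Real.rpow_add (by linarith)]
    -- For `t > 2` the quotient `(t + 1) / (t - 1)` lies in `[1, 3]`; the absolute value in `3 ^
    -- |b|` covers both signs of `b`.
    have h3 : (t + 1) ^ b ≤ 3 ^ |b| * (t - 1) ^ b := by
      have hq : 1 ≤ (t + 1) / (t - 1) := by rw [le_div_iff₀ (by linarith)]; linarith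
      have hq' : (t + 1) / (t - 1) ≤ 3 := by rw [div_le_iff₀ (by linarith)]; linarith
      have : (t + 1) ^ b = ((t + 1) / (t - 1)) ^ b * (t - 1) ^ b := by
        rw [← Real.mul_rpow (by linarith) (by linarith), div_mul_cancel₀ _ (by linarith)]
      rw [this]
      have hp : 0 ≤ (t - 1) ^ b := Real.rpow_nonneg (by linarith) _
      gcongr
      exact (Real.rpow_le_rpow_of_exponent_le hq (le_abs_self b)).trans
        (Real.rpow_le_rpow (by linarith) hq' (abs_nonneg b))
    have hp : 0 ≤ (t - 1) ^ a := Real.rpow_nonneg (by linarith) _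
    calc (t - 1) ^ a * (t + 1) ^ b ≤ (t - 1) ^ a * (3 ^ |b| * (t - 1) ^ b) := by gcongr
      _ = _ := by ring

theorem integral_realWeight_pos {a b : ℝ} (ha : -1 < a) (hab : a + b < -1) :
    0 < ∫ t in Set.Ioi 1, realWeight a b t := by
  rw [setIntegral_pos_iff_support_of_nonneg_ae]
  · have : Set.Ioi (1 : ℝ) ⊆ Function.support (realWeight a b) ∩ Set.Ioi 1 := fun t ht =>
      ⟨(realWeight_pos a b ht).ne', ht⟩
    refine lt_of_lt_of_le ?_ (measure_mono this)
    simp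
  · rw [EventuallyLE, ae_restrict_iff' measurableSet_Ioi]
    exact Eventually.of_forall fun t ht => (realWeight_pos a b ht).le
  · exact integrableOn_realWeight ha hab

/-- Integration by parts gives the same recursion as `IsCurveOne.hasContourIntegral_shift`, so the
ratio of the two integrals is invariant under the shift. -/
theorem integral_realWeight_shift {a b : ℝ} (ha : -1 < a) (hab : a + b < -1) :
    (a + 1) * ∫ t in Set.Ioi 1, realWeight a b t =
      -b * ∫ t in Set.Ioi 1, realWeight (a + 1) (b - 1) t := by
  have i1 := (integrableOn_realWeight ha hab).const_mul (a + 1)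
  have i2 := (integrableOn_realWeight (a := a + 1) (b := b - 1) (by linarith)
    (by linarith)).const_mul b
  have hd : ∀ t ∈ Set.Ioi (1 : ℝ), HasDerivAt (realWeight (a + 1) b)
      ((a + 1) * realWeight a b t + b * realWeight (a + 1) (b - 1) t) t := by
    intro t ht
    have ht : 1 < t := ht
    have h1 : HasDerivAt (fun t : ℝ => t - 1) 1 t := (hasDerivAt_id t).sub_const 1
    have h2 : HasDerivAt (fun t : ℝ => t + 1) 1 t := (hasDerivAt_id t).add_const 1
    have := (h1.rpow_const (p := a + 1) (Or.inl (by linarith))).mul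
      (h2.rpow_const (p := b) (Or.inl (by linarith)))
    convert! this using 1
    simp only [realWeight, add_sub_cancel_right]
    ring
  have hc : ContinuousWithinAt (realWeight (a + 1) b) (Set.Ici 1) 1 := by
    refine ContinuousAt.continuousWithinAt (ContinuousAt.mul ?_ ?_)
    · exact ContinuousAt.rpow_const (by fun_prop) (Or.inr (by linarith))
    · exact ContinuousAt.rpow_const (by fun_prop) (Or.inl (by norm_num))
  have hlim : Tendsto (realWeight (a + 1) b) atTop (𝓝 0) := by
    have h1 : Tendsto (fun t : ℝ => (t + 1) ^ (a + 1 + b)) atTop (𝓝 0) := by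
      have := (tendsto_rpow_neg_atTop (y := -(a + 1 + b)) (by linarith)).comp
        (tendsto_atTop_add_const_right atTop (1 : ℝ) tendsto_id)
      simpa [Function.comp_def] using this
    refine squeeze_zero' ?_ ?_ h1
    · filter_upwards [eventually_gt_atTop 1] with t ht using (realWeight_pos _ _ ht).le
    · filter_upwards [eventually_gt_atTop 1] with t ht
      rw [realWeight, Real.rpow_add (x := t + 1) (by linarith)]
      have hp : 0 ≤ (t + 1) ^ b := Real.rpow_nonneg (by linarith) _
      gcongr
      · linarith
      · linarith
  have := integral_Ioi_of_hasDerivAt_of_tendsto hc hd (i1.add i2) hlim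
  rw [integral_add i1 i2, integral_const_mul, integral_const_mul] at this
  have h0 : realWeight (a + 1) b 1 = 0 := by
    rw [realWeight, sub_self, Real.zero_rpow (by linarith), zero_mul]
  rw [h0] at this
  linarith

/-- Boundary values of the logarithm on the negative axis from the side `0 < σ * im z`. -/
theorem tendsto_log_side {σ : ℝ} (hσ : σ = 1 ∨ σ = -1) {x : ℝ} (hx : 0 < x) :
    Tendsto Complex.log (𝓝[{z : ℂ | 0 < σ * z.im}] (-x : ℂ))
      (𝓝 (Real.log x + σ * Real.pi * Complex.I)) := by
  have hre : (-x : ℂ).re < 0 := by simpa using hx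
  have him : (-x : ℂ).im = 0 := by simp
  rcases hσ with rfl | rfl
  · have := Complex.tendsto_log_nhdsWithin_im_nonneg_of_re_neg_of_im_zero hre him
    rw [norm_neg, Complex.norm_real, Real.norm_of_nonneg hx.le] at this
    have h2 := this.mono_left (nhdsWithin_mono _ (s := {z : ℂ | 0 < 1 * z.im})
      fun z hz => by
        have hz : 0 < 1 * z.im := hz
        show 0 ≤ z.im
        linarith)
    simpa using h2
  · have := Complex.tendsto_log_nhdsWithin_im_neg_of_re_neg_of_im_zero hre him
    rw [norm_neg, Complex.norm_real, Real.norm_of_nonneg hx.le] at this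
    have h2 := this.mono_left (nhdsWithin_mono _ (s := {z : ℂ | 0 < -1 * z.im})
      fun z hz => by
        have hz : 0 < -1 * z.im := hz
        show z.im < 0
        linarith)
    simpa [sub_eq_add_neg] using h2

theorem tendsto_cpow_side {σ : ℝ} (hσ : σ = 1 ∨ σ = -1) {x : ℝ} (hx : 0 < x) (c : ℝ) :
    Tendsto (fun z : ℂ => z ^ (c : ℂ)) (𝓝[{z : ℂ | 0 < σ * z.im}] (-x : ℂ))
      (𝓝 ((x ^ c : ℝ) * Complex.exp (σ * Real.pi * Complex.I * c))) := by
  have h := (tendsto_log_side hσ hx).mul_const (c : ℂ)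
  have h2 := (Complex.continuous_exp.tendsto _).comp h
  have e : ((x ^ c : ℝ) : ℂ) * Complex.exp (σ * Real.pi * Complex.I * c) =
      Complex.exp ((Real.log x + σ * Real.pi * Complex.I) * c) := by
    rw [add_mul, Complex.exp_add, Real.rpow_def_of_pos hx]
    push_cast
    rfl
  rw [e]
  refine h2.congr' ?_
  filter_upwards [self_mem_nhdsWithin] with z hz
  have : z ≠ 0 := by
    rintro rfl
    simp at hz
  rw [Complex.cpow_def_of_ne_zero this]
  rfl

end

/-! ### The radial primitive of the weight -/

noncomputable section

/-- The integrand of the radial primitive of the weight. -/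
def radialIntegrand (b c : ℝ) (r : ℝ) (ζ : ℂ) : ℂ := ((r ^ b : ℝ) : ℂ) * (2 - r * ζ) ^ (c : ℂ)

/-- The dominating function is uniform on bounded sets of `ζ`, up to the cut; `0 ≤ c` rules out a
singularity where `2 - r ζ` vanishes. -/
theorem norm_radialIntegrand_le {b c r M : ℝ} {ζ : ℂ} (hc : 0 ≤ c) (hr : 1 ≤ r) (hζ : ‖ζ‖ ≤ M) :
    ‖radialIntegrand b c r ζ‖ ≤ (2 + M) ^ c * r ^ (b + c) := by
  have hM : 0 ≤ M := (norm_nonneg _).trans hζ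
  have hr0 : 0 < r := by linarith
  rw [radialIntegrand, norm_mul, Complex.norm_real,
    Real.norm_of_nonneg (Real.rpow_nonneg hr0.le _), Complex.norm_cpow_real, Real.rpow_add hr0]
  have h1 : ‖2 - r * ζ‖ ≤ (2 + M) * r := by
    calc ‖2 - r * ζ‖ ≤ ‖(2 : ℂ)‖ + ‖(r : ℂ) * ζ‖ := norm_sub_le _ _
      _ = 2 + r * ‖ζ‖ := by rw [norm_mul, Complex.norm_real, Real.norm_of_nonneg hr0.le]; simp
      _ ≤ 2 * r + r * M := by gcongr; linarith
      _ = _ := by ring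
  calc r ^ b * ‖2 - r * ζ‖ ^ c ≤ r ^ b * ((2 + M) * r) ^ c := by gcongr
    _ = _ := by rw [Real.mul_rpow (by linarith) hr0.le]; ring

theorem two_sub_mem_slitPlane {ζ : ℂ} (hζ : -ζ ∈ Complex.slitPlane) {r : ℝ} (hr : 0 < r) :
    2 - r * ζ ∈ Complex.slitPlane := by
  have := add_mem_slitPlane hζ (x := 2) (by norm_num) hr
  convert this using 1
  push_cast
  ring

theorem hasDerivAt_radialIntegrand (b c : ℝ) {r : ℝ} (hr : 0 < r) {ζ : ℂ}
    (hζ : -ζ ∈ Complex.slitPlane) :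
    HasDerivAt (radialIntegrand b c r) (-c * radialIntegrand (b + 1) (c - 1) r ζ) ζ := by
  have h1 : HasDerivAt (fun ζ : ℂ => 2 - r * ζ) (-r) ζ := by
    simpa using ((hasDerivAt_id ζ).const_mul (r : ℂ)).const_sub 2
  have := (h1.cpow_const (c := (c : ℂ)) (two_sub_mem_slitPlane hζ hr)).const_mul ((r ^ b : ℝ) : ℂ)
  convert! this using 1
  simp only [radialIntegrand]
  rw [Real.rpow_add_one hr.ne']
  push_cast
  ring

theorem hasDerivAt_radialIntegrand_param (b c : ℝ) {r : ℝ} (hr : 0 < r) {ζ : ℂ}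
    (hζ : -ζ ∈ Complex.slitPlane) :
    HasDerivAt (fun r : ℝ => radialIntegrand (b + 1) c r ζ)
      ((b + 1) * radialIntegrand b c r ζ - c * ζ * radialIntegrand (b + 1) (c - 1) r ζ) r := by
  have h1 : HasDerivAt (fun r : ℝ => 2 - (r : ℂ) * ζ) (-ζ) r := by
    simpa using ((Complex.ofRealCLM.hasDerivAt (x := r)).mul_const ζ).const_sub 2
  have h2 := (Real.hasDerivAt_rpow_const (p := b + 1) (Or.inl hr.ne')).ofReal_comp
  have h3 : HasDerivAt (fun r : ℝ => (2 - (r : ℂ) * ζ) ^ (c : ℂ))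
      (c * (2 - (r : ℂ) * ζ) ^ ((c : ℂ) - 1) * (-ζ)) r :=
    (hasDerivAt_id _).cpow_const (c := (c : ℂ)) (two_sub_mem_slitPlane hζ hr)
      |>.comp_of_eq r h1 rfl |>.congr_deriv (by simp)
  have := h2.mul h3
  convert! this using 1
  simp only [radialIntegrand]
  rw [add_sub_cancel_right]
  push_cast
  ring

theorem continuousOn_radialIntegrand_param (b c : ℝ) {ζ : ℂ} (hζ : -ζ ∈ Complex.slitPlane) :
    ContinuousOn (fun r : ℝ => radialIntegrand b c r ζ) (Set.Ioi 0) := by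
  intro r hr
  have := (hasDerivAt_radialIntegrand_param (b - 1) c hr hζ).continuousAt.continuousWithinAt
    (s := Set.Ioi 0)
  simpa using this

theorem aestronglyMeasurable_radialIntegrand (b c : ℝ) {ζ : ℂ} (hζ : -ζ ∈ Complex.slitPlane) :
    AEStronglyMeasurable (fun r : ℝ => radialIntegrand b c r ζ) (volume.restrict (Set.Ioi 1)) :=
  ((continuousOn_radialIntegrand_param b c hζ).mono
    (Set.Ioi_subset_Ioi zero_le_one)).aestronglyMeasurable measurableSet_Ioi

theorem integrableOn_radialIntegrand {b c : ℝ} (hc : 0 ≤ c) (hbc : b + c < -1) {ζ : ℂ}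
    (hζ : -ζ ∈ Complex.slitPlane) :
    IntegrableOn (fun r : ℝ => radialIntegrand b c r ζ) (Set.Ioi 1) := by
  refine ((integrableOn_Ioi_rpow_of_lt hbc one_pos).const_mul ((2 + ‖ζ‖) ^ c)).mono'
    (aestronglyMeasurable_radialIntegrand b c hζ) ?_
  rw [ae_restrict_iff' measurableSet_Ioi]
  exact Eventually.of_forall fun r hr => norm_radialIntegrand_le hc (le_of_lt hr) le_rfl

/-- Differentiation turns `(b, c)` into `(b + 1, c - 1)`, so the decay exponent `b + c` persists; `1
≤ c` keeps the new exponent nonnegative for the domination. -/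
theorem hasDerivAt_integral_radialIntegrand {b c : ℝ} (hc : 1 ≤ c) (hbc : b + c < -1) {ζ : ℂ}
    (hζ : -ζ ∈ Complex.slitPlane) :
    HasDerivAt (fun ζ => ∫ r in Set.Ioi (1 : ℝ), radialIntegrand b c r ζ)
      (∫ r in Set.Ioi (1 : ℝ), -c * radialIntegrand (b + 1) (c - 1) r ζ) ζ := by
  have hopen : IsOpen {ζ : ℂ | -ζ ∈ Complex.slitPlane} :=
    Complex.isOpen_slitPlane.preimage continuous_neg
  have hs : {ζ : ℂ | -ζ ∈ Complex.slitPlane} ∩ Metric.ball ζ 1 ∈ 𝓝 ζ :=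
    inter_mem (hopen.mem_nhds hζ) (Metric.ball_mem_nhds ζ one_pos)
  refine (hasDerivAt_integral_of_dominated_loc_of_deriv_le (𝕜 := ℂ)
    (F := fun ζ r => radialIntegrand b c r ζ)
    (F' := fun ζ r => -c * radialIntegrand (b + 1) (c - 1) r ζ)
    (bound := fun r => c * ((2 + (‖ζ‖ + 1)) ^ (c - 1) * r ^ (b + c)))
    hs ?_ (integrableOn_radialIntegrand (by linarith) hbc hζ) ?_ ?_ ?_ ?_).2
  · filter_upwards [hopen.mem_nhds hζ] with z hz using aestronglyMeasurable_radialIntegrand b c hz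
  · exact (aestronglyMeasurable_radialIntegrand _ _ hζ).const_mul _
  · rw [ae_restrict_iff' measurableSet_Ioi]
    refine Eventually.of_forall fun r hr z hz => ?_
    have hz' : ‖z‖ ≤ ‖ζ‖ + 1 := by
      have h1 := hz.2
      rw [Metric.mem_ball, dist_eq_norm] at h1
      have h2 := norm_add_le (z - ζ) ζ
      rw [sub_add_cancel] at h2
      linarith
    rw [norm_mul, norm_neg, Complex.norm_real, Real.norm_of_nonneg (by linarith)]
    have := norm_radialIntegrand_le (b := b + 1) (c := c - 1) (by linarith)
      (le_of_lt hr : (1 : ℝ) ≤ r) hz'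
    rw [show b + 1 + (c - 1) = b + c by ring] at this
    gcongr
  · exact ((integrableOn_Ioi_rpow_of_lt hbc one_pos).const_mul _).const_mul _
  · rw [ae_restrict_iff' measurableSet_Ioi]
    exact Eventually.of_forall fun r hr z hz =>
      hasDerivAt_radialIntegrand b c (zero_lt_one.trans hr) hz.1

/-- This is the integral over `(1, ∞)` of the `r`-derivative of `r ^ (b + 1) * (2 - r ζ) ^ c`; only
the boundary term at `r = 1` survives. -/
theorem integral_radialIntegrand_relation {b c : ℝ} (hc : 1 ≤ c) (hbc : b + c < -1) {ζ : ℂ}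
    (hζ : -ζ ∈ Complex.slitPlane) :
    (b + 1) * (∫ r in Set.Ioi (1 : ℝ), radialIntegrand b c r ζ) +
      ζ * ∫ r in Set.Ioi (1 : ℝ), -c * radialIntegrand (b + 1) (c - 1) r ζ =
      -(2 - ζ) ^ (c : ℂ) := by
  have i1 := (integrableOn_radialIntegrand (by linarith) hbc hζ).const_mul ((b : ℂ) + 1)
  have i2 := (integrableOn_radialIntegrand (b := b + 1) (c := c - 1) (by linarith) (by linarith)
    hζ).const_mul (c * ζ)
  have hlim : Tendsto (fun r : ℝ => radialIntegrand (b + 1) c r ζ) atTop (𝓝 0) := by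
    have h1 : Tendsto (fun r : ℝ => (2 + ‖ζ‖) ^ c * r ^ (b + 1 + c)) atTop (𝓝 0) := by
      have := (tendsto_rpow_neg_atTop (y := -(b + 1 + c)) (by linarith)).const_mul
        ((2 + ‖ζ‖) ^ c)
      simpa using this
    refine squeeze_zero_norm' ?_ h1
    filter_upwards [eventually_ge_atTop 1] with r hr
    exact norm_radialIntegrand_le (by linarith) hr le_rfl
  have := integral_Ioi_of_hasDerivAt_of_tendsto' (a := (1 : ℝ))
    (fun r hr => hasDerivAt_radialIntegrand_param b c (zero_lt_one.trans_le hr) hζ)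
    (i1.sub i2) hlim
  rw [integral_sub i1 i2, integral_const_mul, integral_const_mul] at this
  rw [integral_const_mul]
  have h1 : radialIntegrand (b + 1) c 1 ζ = (2 - ζ) ^ (c : ℂ) := by
    simp [radialIntegrand]
  rw [h1] at this
  linear_combination this

/-- The primitive of the weight obtained by integrating along rays from `-1` towards infinity. -/
def radialPrimitive (a b : ℝ) (z : ℂ) : ℂ :=
  (-(1 + z)) ^ ((b + 1 : ℝ) : ℂ) * ∫ r in Set.Ioi (1 : ℝ), radialIntegrand b a r (1 + z)

/-- On the ray `-1 + r (1 + z)` the weight is `(-(1 + z)) ^ b` times the radial integrand and the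
line element is `(1 + z) dr`. The function is thus minus the integral of the weight from `z` to
infinity. -/
theorem hasDerivAt_radialPrimitive {a b : ℝ} (ha : 1 ≤ a) (hab : a + b < -1) {z : ℂ}
    (hz : z ∈ cutPlane) : HasDerivAt (radialPrimitive a b) (cutWeight a b z) z := by
  have h1 : HasDerivAt (fun z : ℂ => 1 + z) 1 z := (hasDerivAt_id z).const_add 1
  have h2 : HasDerivAt (fun z : ℂ => -(1 + z)) (-1) z := h1.neg
  have h3 := (hasDerivAt_integral_radialIntegrand ha (by linarith) hz).comp z h1
  have h4 := (h2.cpow_const (c := ((b + 1 : ℝ) : ℂ)) hz).mul h3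
  have hrel := integral_radialIntegrand_relation ha (b := b) (by linarith) hz
  convert! h4 using 1
  have hne := Complex.slitPlane_ne_zero hz
  simp only [Function.comp_apply, cutWeight]
  push_cast
  rw [add_sub_cancel_right, Complex.cpow_add _ _ hne, Complex.cpow_one]
  rw [show (2 : ℂ) - (1 + z) = 1 - z by ring] at hrel
  linear_combination ((-(1 + z)) ^ (b : ℂ)) * hrel

/-- The substitution `t = 2 r - 1` identifies the limiting radial integral at `z = 1`, where `1 + z
= 2`. -/
theorem integral_radialIntegrand_two (a b : ℝ) :
    (2 : ℝ) ^ (b + 1) * ∫ r in Set.Ioi (1 : ℝ), r ^ b * (2 * r - 2) ^ a =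
      ∫ t in Set.Ioi 1, realWeight a b t := by
  have h1 := integral_comp_mul_left_Ioi (fun t : ℝ => realWeight a b (t - 1)) 1
    (two_pos : (0 : ℝ) < 2)
  have h2 : ∫ t in Set.Ioi (2 * 1 : ℝ), realWeight a b (t - 1) =
      ∫ t in Set.Ioi 1, realWeight a b t := by
    have := (measurePreserving_sub_right (volume : Measure ℝ) 1).setIntegral_preimage_emb
      (MeasurableEquiv.subRight (1 : ℝ)).measurableEmbedding (realWeight a b) (Set.Ioi 1)
    rw [Set.preimage_sub_const_Ioi] at this
    rw [← this]
    norm_num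
  rw [h2] at h1
  rw [smul_eq_mul] at h1
  have h3 : ∫ r in Set.Ioi (1 : ℝ), realWeight a b (2 * r - 1) =
      2 ^ b * ∫ r in Set.Ioi (1 : ℝ), r ^ b * (2 * r - 2) ^ a := by
    rw [← integral_const_mul]
    refine setIntegral_congr_fun measurableSet_Ioi fun r hr => ?_
    have hr : 1 < r := hr
    simp only [realWeight]
    rw [show 2 * r - 1 + 1 = 2 * r by ring, Real.mul_rpow (by norm_num) (by linarith),
      show 2 * r - 1 - 1 = 2 * r - 2 by ring]
    ring
  rw [Real.rpow_add_one (by norm_num), mul_assoc, mul_left_comm, ← h3, h1]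
  ring

/-- Boundary values of the radial primitive at `1`. -/
theorem tendsto_radialPrimitive {a b σ : ℝ} (ha : 1 ≤ a) (hab : a + b < -1)
    (hσ : σ = 1 ∨ σ = -1) :
    Tendsto (radialPrimitive a b) (𝓝[{z : ℂ | 0 < σ * z.im}] 1)
      (𝓝 (-Complex.exp (-σ * Real.pi * Complex.I * (a + b : ℝ)) *
        (∫ t in Set.Ioi 1, realWeight a b t : ℝ))) := by
  have hσ' : -σ = 1 ∨ -σ = -1 := by rcases hσ with rfl | rfl <;> simp
  have hcast : (-((2 : ℝ) : ℂ)) = -(1 + 1) := by push_cast; ring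
  have hside : Tendsto (fun z : ℂ => -(1 + z)) (𝓝[{z : ℂ | 0 < σ * z.im}] 1)
      (𝓝[{z : ℂ | 0 < -σ * z.im}] (-((2 : ℝ) : ℂ))) := by
    refine tendsto_nhdsWithin_iff.2 ⟨?_, ?_⟩
    · rw [hcast]
      exact ((continuous_const.add continuous_id).neg.tendsto (1 : ℂ)).mono_left
        nhdsWithin_le_nhds
    · filter_upwards [self_mem_nhdsWithin] with z hz
      have hz : 0 < σ * z.im := hz
      simpa using hz
  have h1 := (tendsto_cpow_side hσ' two_pos (b + 1)).comp hside
  have h2 : Tendsto (fun z => ∫ r in Set.Ioi (1 : ℝ), radialIntegrand b a r (1 + z))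
      (𝓝[{z : ℂ | 0 < σ * z.im}] 1) (𝓝 (∫ r in Set.Ioi (1 : ℝ),
        ((r ^ b * (2 * r - 2) ^ a : ℝ) : ℂ) * Complex.exp (-σ * Real.pi * Complex.I * a))) := by
    refine tendsto_integral_filter_of_dominated_convergence
      (fun r => (2 + 3) ^ a * r ^ (b + a)) ?_ ?_ ?_ ?_
    · filter_upwards [self_mem_nhdsWithin] with z hz
      have hz : 0 < σ * z.im := hz
      refine aestronglyMeasurable_radialIntegrand b a ?_
      rw [Complex.mem_slitPlane_iff]
      right
      intro h0
      simp only [Complex.neg_im, Complex.add_im, Complex.one_im, zero_add, neg_eq_zero] at h0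
      simp [h0] at hz
    -- The `3` in the dominating function is any bound exceeding `‖1 + z‖ = 2` at `z = 1`.
    · have : ∀ᶠ z : ℂ in 𝓝[{z : ℂ | 0 < σ * z.im}] 1, ‖1 + z‖ ≤ 3 := by
        have hc : ContinuousAt (fun z : ℂ => ‖1 + z‖) 1 := by fun_prop
        have : ∀ᶠ z : ℂ in 𝓝 1, ‖1 + z‖ < 3 := hc.eventually_lt_const (by norm_num)
        exact (this.filter_mono nhdsWithin_le_nhds).mono fun z hz => le_of_lt hz
      filter_upwards [this] with z hz
      rw [ae_restrict_iff' measurableSet_Ioi]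
      exact Eventually.of_forall fun r hr =>
        norm_radialIntegrand_le (by linarith) (le_of_lt hr) hz
    · exact (integrableOn_Ioi_rpow_of_lt (by linarith) one_pos).const_mul _
    · rw [ae_restrict_iff' measurableSet_Ioi]
      refine Eventually.of_forall fun r hr => ?_
      have hr : 1 < r := hr
      have hx : 0 < 2 * r - 2 := by linarith
      have hside' : Tendsto (fun z : ℂ => 2 - r * (1 + z)) (𝓝[{z : ℂ | 0 < σ * z.im}] 1)
          (𝓝[{z : ℂ | 0 < -σ * z.im}] (-((2 * r - 2 : ℝ) : ℂ))) := by
        refine tendsto_nhdsWithin_iff.2 ⟨?_, ?_⟩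
        · have : Continuous fun z : ℂ => 2 - r * (1 + z) := by fun_prop
          convert! (this.tendsto (1 : ℂ)).mono_left nhdsWithin_le_nhds using 2
          push_cast
          ring
        · filter_upwards [self_mem_nhdsWithin] with z hz
          have hz : 0 < σ * z.im := hz
          have : 0 < -σ * (-(r * z.im)) := by nlinarith
          simpa using this
      have := ((tendsto_cpow_side hσ' hx a).comp hside').const_mul ((r ^ b : ℝ) : ℂ)
      convert! this using 2
      push_cast
      ring
  have h3 := h1.mul h2
  have hreal : ∫ r in Set.Ioi (1 : ℝ), ((r ^ b * (2 * r - 2) ^ a : ℝ) : ℂ) =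
      ((∫ r in Set.Ioi (1 : ℝ), r ^ b * (2 * r - 2) ^ a : ℝ) : ℂ) := integral_ofReal
  rw [integral_mul_const, hreal] at h3
  rw [← integral_radialIntegrand_two]
  convert! h3 using 2
  -- The prefactor has exponent `b + 1` instead of `b`; the extra half-turn is the source of the
  -- minus sign.
  have hsq : Complex.exp ((-σ : ℝ) * Real.pi * Complex.I) = -1 := by
    rcases hσ with rfl | rfl
    · have : ((-1 : ℝ) : ℂ) * Real.pi * Complex.I = -(Real.pi * Complex.I) := by push_cast; ring
      rw [this, Complex.exp_neg, Complex.exp_pi_mul_I]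
      norm_num
    · have : ((-(-1) : ℝ) : ℂ) * Real.pi * Complex.I = Real.pi * Complex.I := by push_cast; ring
      rw [this, Complex.exp_pi_mul_I]
  push_cast at hsq ⊢
  rw [mul_add, mul_add, Complex.exp_add, Complex.exp_add, mul_one, hsq]
  ring

/-! ### The jump across `(1, ∞)` and the mass of the weight on the curve -/

/-- The ratio between the integrals of the weight over the curve and over `(1, ∞)`. -/
def jumpFactor (s : ℝ) : ℂ := 2 * Complex.I * Complex.sin (Real.pi * s)

theorem jumpFactor_ne_zero {s : ℝ} (hs : ∀ j : ℤ, s ≠ j) : jumpFactor s ≠ 0 := by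
  refine mul_ne_zero (mul_ne_zero two_ne_zero Complex.I_ne_zero) fun h => ?_
  obtain ⟨k, hk⟩ := Complex.sin_eq_zero_iff.1 h
  have hk' : Real.pi * s = k * Real.pi := by exact_mod_cast hk
  exact hs k (mul_left_cancel₀ Real.pi_ne_zero (by rw [hk']; ring))

theorem jumpFactor_add_nat (s : ℝ) (j : ℕ) : jumpFactor (s + j) = (-1) ^ j * jumpFactor s := by
  have : (Real.pi : ℂ) * ((s + j : ℝ) : ℂ) = Real.pi * s + j * Real.pi := by push_cast; ring
  rw [jumpFactor, this, Complex.sin_antiperiodic.add_nat_mul_eq, jumpFactor]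
  ring

variable {γ : ℝ → ℂ} {a b : ℝ}

/-- The boundary values of the radial primitive from above and below differ by the factor `exp
(iπ(a+b)) - exp (-iπ(a+b)) = 2i sin (π(a+b))`. -/
theorem IsCurveOne.hasContourIntegral_cutWeight_of_one_le (hγ : IsCurveOne γ) (ha : 1 ≤ a)
    (hab : a + b < -1) :
    HasContourIntegral (cutWeight a b) γ
      (jumpFactor (a + b) * (∫ t in Set.Ioi 1, realWeight a b t : ℝ)) := by
  have t0 : Tendsto γ (𝓝[>] 0) (𝓝[{z : ℂ | 0 < (-1 : ℝ) * z.im}] 1) :=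
    tendsto_nhdsWithin_iff.2 ⟨hγ.tendsto_zero, hγ.starts_below.mono fun t ht => by
      show 0 < -1 * (γ t).im
      linarith⟩
  have t1 : Tendsto γ (𝓝[<] 1) (𝓝[{z : ℂ | 0 < (1 : ℝ) * z.im}] 1) :=
    tendsto_nhdsWithin_iff.2 ⟨hγ.tendsto_one, hγ.ends_above.mono fun t ht => by
      show 0 < 1 * (γ t).im
      linarith⟩
  have := hasContourIntegral_of_hasDerivAt isOpen_cutPlane
    (fun z hz => hasDerivAt_radialPrimitive ha hab hz) hγ.absCont
    (fun t ht => hγ.mem_cutPlane ht)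
    ((tendsto_radialPrimitive ha hab (Or.inr rfl)).comp t0)
    ((tendsto_radialPrimitive ha hab (Or.inl rfl)).comp t1)
  convert! this using 1
  rw [jumpFactor, Complex.sin]
  have e1 : -((1 : ℝ) : ℂ) * Real.pi * Complex.I * (a + b : ℝ) =
    -(Real.pi * (a + b : ℝ)) * Complex.I := by push_cast; ring
  have e2 : -((-1 : ℝ) : ℂ) * Real.pi * Complex.I * (a + b : ℝ) =
    (Real.pi * (a + b : ℝ)) * Complex.I := by push_cast; ring
  rw [e1, e2]
  linear_combination (∫ t in Set.Ioi 1, realWeight a b t : ℝ) *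
    (Complex.exp (-(Real.pi * (a + b : ℝ)) * Complex.I) -
      Complex.exp ((Real.pi * (a + b : ℝ)) * Complex.I)) * Complex.I_sq

theorem IsCurveOne.hasContourIntegral_cutWeight_of_lt (hγ : IsCurveOne γ) (ha : -1 < a)
    (hab : a + b < -1) :
    HasContourIntegral (cutWeight a b) γ
      (jumpFactor (a + b) * (∫ t in Set.Ioi 1, realWeight a b t : ℝ)) := by
  have step : ∀ a b : ℝ, -1 < a → a + b < -1 →
      HasContourIntegral (cutWeight (a + 1) (b - 1)) γ (jumpFactor (a + 1 + (b - 1)) *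
        (∫ t in Set.Ioi 1, realWeight (a + 1) (b - 1) t : ℝ)) →
      HasContourIntegral (cutWeight a b) γ
        (jumpFactor (a + b) * (∫ t in Set.Ioi 1, realWeight a b t : ℝ)) := by
    intro a b ha hab h
    have h1 := hγ.hasContourIntegral_shift ha h
    have h2 := integral_realWeight_shift ha hab
    have ha' : (a + 1 : ℂ) ≠ 0 := by exact_mod_cast (by linarith : a + 1 ≠ 0)
    rw [show a + 1 + (b - 1) = a + b by ring] at h1
    convert! h1 using 1
    have h3 : ((a : ℂ) + 1) * (∫ t in Set.Ioi 1, realWeight a b t : ℝ) =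
        -b * (∫ t in Set.Ioi 1, realWeight (a + 1) (b - 1) t : ℝ) := by exact_mod_cast h2
    field_simp
    linear_combination jumpFactor (a + b) * h3
  -- Two shifts raise `a > -1` to `a + 2 > 1`, where the primitive is available.
  refine step a b ha hab (step _ _ (by linarith) (by linarith) ?_)
  exact hγ.hasContourIntegral_cutWeight_of_one_le (by linarith) (by linarith)

/-- Lowering `b` by integers reaches the convergent range `a + b < -1`. Coming back, each factor
from `IsCurveOne.hasContourIntegral_raise_right` is finite since `a + b` is not an integer and
nonzero since `b` is not. -/
theorem IsCurveOne.exists_hasContourIntegral_cutWeight (hγ : IsCurveOne γ) (ha : -1 < a)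
    (hb : ∀ j : ℤ, b ≠ j) (hab : ∀ j : ℤ, a + b ≠ j) :
    ∃ I : ℂ, I ≠ 0 ∧ HasContourIntegral (cutWeight a b) γ I := by
  have key : ∀ N : ℕ, ∀ b : ℝ, (∀ j : ℤ, b ≠ j) → (∀ j : ℤ, a + b ≠ j) → a + b < -1 + N →
      ∃ I : ℂ, I ≠ 0 ∧ HasContourIntegral (cutWeight a b) γ I := by
    intro N
    induction N with
    | zero =>
      intro b hb hab h
      have h : a + b < -1 := by simpa using h
      refine ⟨_, mul_ne_zero (jumpFactor_ne_zero hab) ?_,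
        hγ.hasContourIntegral_cutWeight_of_lt ha h⟩
      exact_mod_cast (integral_realWeight_pos ha h).ne'
    | succ N ih =>
      intro b hb hab h
      push_cast at h
      obtain ⟨I, hI, hi⟩ := ih (b - 1)
        (fun j hj => hb (j + 1) (by push_cast; linarith))
        (fun j hj => hab (j + 1) (by push_cast; linarith)) (by linarith)
      have h2 : a + (b - 1) + 2 ≠ 0 := fun h0 => hab (-1) (by push_cast; linarith)
      have h2' : ((a : ℂ) + (b - 1 : ℝ) + 2) ≠ 0 := by exact_mod_cast h2
      have h3 : ((b - 1 : ℝ) : ℂ) + 1 ≠ 0 := by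
        have : b ≠ 0 := by simpa using hb 0
        push_cast
        rw [sub_add_cancel]
        exact_mod_cast this
      have := hγ.hasContourIntegral_raise_right ha h2 hi
      rw [sub_add_cancel] at this
      refine ⟨_, mul_ne_zero (div_ne_zero ?_ h2') hI, this⟩
      exact neg_ne_zero.2 (mul_ne_zero two_ne_zero h3)
  obtain ⟨N, hN⟩ := exists_nat_gt (a + b + 1)
  exact key N b hb hab (by linarith)

end

/-! ### Polynomial multiples of the weight -/

noncomputable section

section Moments

variable {a b : ℝ}

/-- Expansion around `-1` makes each monomial merely raise the exponent `b`, reducing polynomial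
multiples to pure weights. -/
theorem eval_eq_sum_one_add_pow (q : ℂ[X]) (z : ℂ) :
    q.eval z = ∑ j ∈ Finset.range (q.natDegree + 1), (taylor (-1) q).coeff j * (1 + z) ^ j := by
  have h := eval_eq_sum_range (p := taylor (-1) q) (1 + z)
  rw [natDegree_taylor, taylor_eval] at h
  rw [← h]
  congr 1
  ring

/-- The sign `(-1) ^ j`, from the base `-(1 + z)`, cancels the one in `jumpFactor_add_nat`; so a
single jump factor serves all terms of a polynomial. -/
theorem cutWeight_add_nat (a b : ℝ) (j : ℕ) {z : ℂ} (hz : z ∈ cutPlane) :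
    cutWeight a (b + j) z = (-1) ^ j * ((1 + z) ^ j * cutWeight a b z) := by
  induction j with
  | zero => simp
  | succ j ih =>
    push_cast
    rw [← add_assoc, cutWeight_add_one_right a _ hz, ih]
    ring

theorem realWeight_add_nat (a b : ℝ) (j : ℕ) {t : ℝ} (ht : 1 < t) :
    realWeight a (b + j) t = (t + 1) ^ j * realWeight a b t := by
  induction j with
  | zero => simp
  | succ j ih =>
    push_cast
    rw [← add_assoc, realWeight_add_one_right a _ ht, ih]
    ring

theorem eval_mul_realWeight_eq_sum (q : ℂ[X]) {t : ℝ} (ht : 1 < t) :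
    q.eval (t : ℂ) * (realWeight a b t : ℝ) = ∑ j ∈ Finset.range (q.natDegree + 1),
      (taylor (-1) q).coeff j * (realWeight a (b + j) t : ℝ) := by
  rw [eval_eq_sum_one_add_pow, Finset.sum_mul]
  refine Finset.sum_congr rfl fun j _ => ?_
  rw [realWeight_add_nat a b j ht]
  push_cast
  ring

theorem add_nat_lt_of_mem_range {q : ℂ[X]} (hq : a + b + q.natDegree < -1) {j : ℕ}
    (hj : j ∈ Finset.range (q.natDegree + 1)) : a + (b + j) < -1 := by
  have : (j : ℝ) ≤ q.natDegree := by exact_mod_cast Finset.mem_range_succ_iff.1 hj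
  linarith

theorem integrableOn_eval_mul_realWeight (ha : -1 < a) {q : ℂ[X]}
    (hq : a + b + q.natDegree < -1) :
    IntegrableOn (fun t : ℝ => q.eval (t : ℂ) * (realWeight a b t : ℝ)) (Set.Ioi 1) := by
  refine IntegrableOn.congr_fun (f := fun t : ℝ => ∑ j ∈ Finset.range (q.natDegree + 1),
      (taylor (-1) q).coeff j * (realWeight a (b + j) t : ℝ)) ?_
    (fun t ht => (eval_mul_realWeight_eq_sum q ht).symm) measurableSet_Ioi
  refine integrable_finsetSum _ fun j hj => ?_
  exact (integrableOn_realWeight ha (add_nat_lt_of_mem_range hq hj)).ofReal.const_mul _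

variable {γ : ℝ → ℂ}

theorem IsCurveOne.hasContourIntegral_eval_mul_cutWeight_of_sum (hγ : IsCurveOne γ) (q : ℂ[X])
    {I : ℕ → ℂ} (hI : ∀ j ∈ Finset.range (q.natDegree + 1),
      HasContourIntegral (cutWeight a (b + j)) γ (I j)) :
    HasContourIntegral (fun z => q.eval z * cutWeight a b z) γ
      (∑ j ∈ Finset.range (q.natDegree + 1), (taylor (-1) q).coeff j * (-1) ^ j * I j) := by
  refine (HasContourIntegral.sum _ fun j hj =>
    (hI j hj).const_mul ((taylor (-1) q).coeff j * (-1) ^ j)).congr fun t ht => ?_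
  rw [eval_eq_sum_one_add_pow, Finset.sum_mul]
  refine Finset.sum_congr rfl fun j _ => ?_
  rw [cutWeight_add_nat a b j (hγ.mem_cutPlane ht)]
  have : ((-1 : ℂ) ^ j) * (-1) ^ j = 1 := by rw [← mul_pow]; simp
  linear_combination ((taylor (-1) q).coeff j * (1 + γ t) ^ j * cutWeight a b (γ t)) * this

/-- If the integrand decays fast enough, the curve can be deformed to the two sides of
`(1, ∞)`. -/
theorem IsCurveOne.hasContourIntegral_eval_mul_cutWeight_of_lt (hγ : IsCurveOne γ) (ha : -1 < a)
    {q : ℂ[X]} (hq : a + b + q.natDegree < -1) :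
    HasContourIntegral (fun z => q.eval z * cutWeight a b z) γ (jumpFactor (a + b) *
      ∫ t in Set.Ioi (1 : ℝ), q.eval (t : ℂ) * (realWeight a b t : ℝ)) := by
  have h := hγ.hasContourIntegral_eval_mul_cutWeight_of_sum q fun j hj =>
    hγ.hasContourIntegral_cutWeight_of_lt ha (add_nat_lt_of_mem_range hq hj)
  convert! h using 1
  rw [setIntegral_congr_fun measurableSet_Ioi fun t ht =>
    eval_mul_realWeight_eq_sum (a := a) (b := b) q ht, integral_finsetSum, Finset.mul_sum]
  · refine Finset.sum_congr rfl fun j _ => ?_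
    have e : ∫ t in Set.Ioi (1 : ℝ), ((realWeight a (b + j) t : ℝ) : ℂ) =
      ((∫ t in Set.Ioi (1 : ℝ), realWeight a (b + j) t : ℝ) : ℂ) := integral_ofReal
    rw [integral_const_mul, e, ← add_assoc, jumpFactor_add_nat]
    have : ((-1 : ℂ) ^ j) * (-1) ^ j = 1 := by rw [← mul_pow]; simp
    linear_combination -((taylor (-1) q).coeff j * jumpFactor (a + b) *
      (∫ t in Set.Ioi (1 : ℝ), realWeight a (b + j) t : ℝ)) * this
  · intro j hj
    exact (integrableOn_realWeight ha (add_nat_lt_of_mem_range hq hj)).ofReal.const_mul _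

end Moments

/-! ### Jacobi polynomials and their orthogonality on the curve -/

section Jacobi

theorem ringChoose_succ (x : ℂ) (j : ℕ) :
    (j + 1) * Ring.choose x (j + 1) = (x - j) * Ring.choose x j := by
  have h := Ring.choose_smul_choose x (Nat.le_succ j)
  simp only [Nat.succ_eq_add_one, Nat.choose_succ_self_right, add_tsub_cancel_left,
    Ring.choose_one_right, nsmul_eq_mul] at h
  push_cast at h
  rw [h]
  ring

theorem ringChoose_ne_zero {x : ℂ} (hx : ∀ j : ℕ, x ≠ j) (n : ℕ) : Ring.choose x n ≠ 0 := by
  induction n with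
  | zero => simp
  | succ n ih =>
    intro h
    have := ringChoose_succ x n
    rw [h, mul_zero] at this
    exact mul_ne_zero (sub_ne_zero.2 (hx n)) ih this.symm

theorem X_sub_one_mul_derivative_pow (k : ℕ) :
    (X - 1 : ℂ[X]) * derivative ((X - 1 : ℂ[X]) ^ k) = (k : ℂ[X]) * (X - 1) ^ k := by
  cases k with
  | zero => simp
  | succ k =>
    rw [derivative_pow_succ]
    simp only [derivative_sub, derivative_X, derivative_one, sub_zero, mul_one, map_add,
      map_natCast, map_one]
    push_cast
    ring

theorem X_add_one_mul_derivative_pow (k : ℕ) :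
    (X + 1 : ℂ[X]) * derivative ((X + 1 : ℂ[X]) ^ k) = (k : ℂ[X]) * (X + 1) ^ k := by
  cases k with
  | zero => simp
  | succ k =>
    rw [derivative_pow_succ]
    simp only [derivative_X, derivative_one, add_zero, mul_one, map_add,
      map_natCast, map_one]
    push_cast
    ring

/-- The raising relation between Jacobi polynomials: the derivative of
`(1-z)^(α+1) (1+z)^(β+1) P_n^(α+1,β+1)` is `-2(n+1) (1-z)^α (1+z)^β P_{n+1}^(α,β)`. -/
theorem jacobi_succ (n : ℕ) (α β : ℂ) :
    (X - 1) * (X + 1) * derivative (jacobi n (α + 1) (β + 1)) +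
      (C (α + 1) * (X + 1) + C (β + 1) * (X - 1)) * jacobi n (α + 1) (β + 1) =
      C (2 * (n + 1) : ℂ) * jacobi (n + 1) α β := by
  set x : ℂ := n + (α + 1) with hx
  set y : ℂ := n + (β + 1) with hy
  have hx' : ((n + 1 : ℕ) : ℂ) + α = x := by rw [hx]; push_cast; ring
  have hy' : ((n + 1 : ℕ) : ℂ) + β = y := by rw [hy]; push_cast; ring
  -- The `k`-th summand on the left feeds only the terms `k` and `k + 1` of degree `n + 1`.
  have term : ∀ k ∈ Finset.range (n + 1),
      (X - 1) * (X + 1) * derivative (C (Ring.choose x (n - k) * Ring.choose y k) *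
        ((X - 1) ^ k * (X + 1) ^ (n - k))) +
      (C (α + 1) * (X + 1) + C (β + 1) * (X - 1)) *
        (C (Ring.choose x (n - k) * Ring.choose y k) * ((X - 1) ^ k * (X + 1) ^ (n - k))) =
      C (((n + 1 - k : ℕ) : ℂ) * (Ring.choose x (n + 1 - k) * Ring.choose y k)) *
        ((X - 1) ^ k * (X + 1) ^ (n + 1 - k)) +
      C (((k + 1 : ℕ) : ℂ) * (Ring.choose x (n + 1 - (k + 1)) * Ring.choose y (k + 1))) *
        ((X - 1) ^ (k + 1) * (X + 1) ^ (n + 1 - (k + 1))) := by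
    intro k hk
    obtain ⟨j, rfl⟩ : ∃ j, n = k + j := Nat.exists_eq_add_of_le (Finset.mem_range_succ_iff.1 hk)
    have e1 : k + j - k = j := by omega
    have e2 : k + j + 1 - k = j + 1 := by omega
    have e3 : k + j + 1 - (k + 1) = j := by omega
    rw [e1, e2, e3]
    have c1 : ((j + 1 : ℕ) : ℂ) * (Ring.choose x (j + 1) * Ring.choose y k) =
        (k + α + 1) * (Ring.choose x j * Ring.choose y k) := by
      have := ringChoose_succ x j
      push_cast at hx ⊢
      rw [← mul_assoc, this, hx]
      ring
    have c2 : ((k + 1 : ℕ) : ℂ) * (Ring.choose x j * Ring.choose y (k + 1)) =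
        (j + β + 1) * (Ring.choose x j * Ring.choose y k) := by
      have := ringChoose_succ y k
      push_cast at hy ⊢
      rw [mul_left_comm, this, hy]
      ring
    rw [c1, c2, derivative_C_mul, derivative_mul]
    have d1 := X_sub_one_mul_derivative_pow k
    have d2 := X_add_one_mul_derivative_pow j
    simp only [map_mul, map_add, map_natCast, map_one]
    linear_combination (C (Ring.choose x j) * C (Ring.choose y k)) *
      ((X + 1) ^ (j + 1) * d1 + (X - 1) ^ (k + 1) * d2)
  -- The factor `n + 1` is distributed as `(n + 1 - k) + k`; the second share vanishes at `k = 0`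
  -- and the first at `k = n + 1`.
  have split : ∑ k ∈ Finset.range (n + 1 + 1),
      C (((n + 1 : ℕ) : ℂ) * (Ring.choose x (n + 1 - k) * Ring.choose y k)) *
        ((X - 1 : ℂ[X]) ^ k * (X + 1) ^ (n + 1 - k)) =
      ∑ k ∈ Finset.range (n + 1),
        C (((n + 1 - k : ℕ) : ℂ) * (Ring.choose x (n + 1 - k) * Ring.choose y k)) *
          ((X - 1) ^ k * (X + 1) ^ (n + 1 - k)) +
      ∑ k ∈ Finset.range (n + 1),
        C (((k + 1 : ℕ) : ℂ) * (Ring.choose x (n + 1 - (k + 1)) * Ring.choose y (k + 1))) *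
          ((X - 1) ^ (k + 1) * (X + 1) ^ (n + 1 - (k + 1))) := by
    have s1 := Finset.sum_range_succ (fun k =>
      C (((n + 1 - k : ℕ) : ℂ) * (Ring.choose x (n + 1 - k) * Ring.choose y k)) *
          ((X - 1 : ℂ[X]) ^ k * (X + 1) ^ (n + 1 - k))) (n + 1)
    have s2 := Finset.sum_range_succ' (fun k =>
      C ((k : ℂ) * (Ring.choose x (n + 1 - k) * Ring.choose y k)) *
          ((X - 1 : ℂ[X]) ^ k * (X + 1) ^ (n + 1 - k))) (n + 1)
    simp only [Nat.sub_self, Nat.cast_zero, zero_mul, map_zero, add_zero] at s1 s2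
    rw [← s1, ← s2, ← Finset.sum_add_distrib]
    refine Finset.sum_congr rfl fun k hk => ?_
    have : ((n + 1 : ℕ) : ℂ) = ((n + 1 - k : ℕ) : ℂ) + k := by
      rw [Nat.cast_sub (Finset.mem_range_succ_iff.1 hk)]
      ring
    rw [this]
    simp only [add_mul, map_add]
  have hL := Finset.sum_congr rfl term
  rw [Finset.sum_add_distrib, Finset.sum_add_distrib, ← split] at hL
  rw [← Finset.mul_sum, ← Finset.mul_sum, ← derivative_sum] at hL
  have hR : C (2 * (n + 1) : ℂ) * jacobi (n + 1) α β = C ((2 : ℂ)⁻¹ ^ n) *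
      ∑ k ∈ Finset.range (n + 1 + 1),
        C (((n + 1 : ℕ) : ℂ) * (Ring.choose x (n + 1 - k) * Ring.choose y k)) *
        ((X - 1 : ℂ[X]) ^ k * (X + 1) ^ (n + 1 - k)) := by
    simp only [jacobi, hx', hy', map_mul C ((n + 1 : ℕ) : ℂ), mul_assoc, ← Finset.mul_sum]
    simp only [← mul_assoc, ← map_mul]
    congr 2
    push_cast
    rw [pow_succ]
    field_simp
  rw [hR, ← hL, jacobi, derivative_C_mul, ← hx, ← hy]
  ring

theorem jacobi_zero (α β : ℂ) : jacobi 0 α β = 1 := by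
  simp [jacobi]

theorem monic_X_sub_one_pow_mul (k j : ℕ) :
    ((X - 1 : ℂ[X]) ^ k * (X + 1) ^ j).Monic ∧
      ((X - 1 : ℂ[X]) ^ k * (X + 1) ^ j).natDegree = k + j := by
  have h1 : (X - 1 : ℂ[X]).Monic := by simpa using monic_X_sub_C (1 : ℂ)
  have h2 : (X + 1 : ℂ[X]).Monic := by simpa using monic_X_add_C (1 : ℂ)
  have d1 : (X - 1 : ℂ[X]).natDegree = 1 := by simpa using natDegree_X_sub_C (1 : ℂ)
  have d2 : (X + 1 : ℂ[X]).natDegree = 1 := by simpa using natDegree_X_add_C (1 : ℂ)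
  refine ⟨(h1.pow k).mul (h2.pow j), ?_⟩
  rw [(h1.pow k).natDegree_mul (h2.pow j), h1.natDegree_pow, h2.natDegree_pow, d1, d2]
  simp

theorem natDegree_jacobi_le (n : ℕ) (α β : ℂ) : (jacobi n α β).natDegree ≤ n := by
  refine (natDegree_C_mul_le _ _).trans (natDegree_sum_le_of_forall_le _ _ fun k hk => ?_)
  refine (natDegree_C_mul_le _ _).trans (le_of_eq ?_)
  rw [(monic_X_sub_one_pow_mul k (n - k)).2]
  have := Finset.mem_range_succ_iff.1 hk
  omega

/-- All products of powers are monic of degree `n`, so the coefficient is a Chu–Vandermonde sum. -/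
theorem coeff_jacobi (n : ℕ) (α β : ℂ) :
    (jacobi n α β).coeff n = (2 : ℂ)⁻¹ ^ n * Ring.choose (2 * n + α + β) n := by
  rw [jacobi, coeff_C_mul, finsetSum_coeff]
  congr 1
  have h := Ring.add_choose_eq n (Commute.all ((n : ℂ) + β) (n + α))
  rw [show (n : ℂ) + β + (n + α) = 2 * n + α + β by ring,
    Finset.Nat.sum_antidiagonal_eq_sum_range_succ
      (fun i j => Ring.choose ((n : ℂ) + β) i * Ring.choose ((n : ℂ) + α) j)] at h
  rw [h]
  refine Finset.sum_congr rfl fun k hk => ?_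
  obtain ⟨hm, hd⟩ := monic_X_sub_one_pow_mul k (n - k)
  have hk := Finset.mem_range_succ_iff.1 hk
  have : ((X - 1 : ℂ[X]) ^ k * (X + 1) ^ (n - k)).coeff n = 1 := by
    have := hm.coeff_natDegree
    rwa [hd, show k + (n - k) = n by omega] at this
  rw [coeff_C_mul, this]
  ring

theorem coeff_jacobi_ne_zero (n : ℕ) {a b : ℝ} (hab : ∀ j : ℤ, a + b ≠ j) :
    (jacobi n a b).coeff n ≠ 0 := by
  rw [coeff_jacobi]
  refine mul_ne_zero (pow_ne_zero _ (by norm_num)) (ringChoose_ne_zero (fun j hj => ?_) n)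
  refine hab (j - 2 * n) ?_
  have : (2 * n + a + b : ℝ) = j := by exact_mod_cast hj
  push_cast
  linarith

theorem natDegree_jacobi (n : ℕ) {a b : ℝ} (hab : ∀ j : ℤ, a + b ≠ j) :
    (jacobi n a b).natDegree = n :=
  le_antisymm (natDegree_jacobi_le n _ _)
    (le_natDegree_of_ne_zero (coeff_jacobi_ne_zero n hab))

variable {γ : ℝ → ℂ}

/-- Orthogonality of the Jacobi polynomial along the curve. -/
theorem IsCurveOne.exists_hasContourIntegral_jacobi (hγ : IsCurveOne γ) (n : ℕ) :
    ∀ {a b : ℝ}, -1 < a → (∀ j : ℤ, b ≠ j) → (∀ j : ℤ, a + b ≠ j) →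
    ∃ I : ℂ, I ≠ 0 ∧ ∀ q : ℂ[X], q.natDegree ≤ n →
      HasContourIntegral (fun z => q.eval z * (jacobi n a b).eval z * cutWeight a b z) γ
        (q.coeff n * I) := by
  induction n with
  | zero =>
    intro a b ha hb hab
    obtain ⟨I, hI, hi⟩ := hγ.exists_hasContourIntegral_cutWeight ha hb hab
    refine ⟨I, hI, fun q hq => ?_⟩
    refine (hi.const_mul (q.coeff 0)).congr fun t _ => ?_
    rw [eq_C_of_natDegree_le_zero hq, jacobi_zero]
    simp
  | succ n ih =>
    intro a b ha hb hab
    obtain ⟨I, hI, hi⟩ := ih (a := a + 1) (b := b + 1) (by linarith)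
      (fun j hj => hb (j - 1) (by push_cast; linarith))
      (fun j hj => hab (j - 2) (by push_cast; linarith))
    -- Integration by parts gives the sign; the factor `n + 1` from the top coefficient of
    -- `derivative q` cancels against `2 (n + 1)` in `jacobi_succ`.
    refine ⟨-I / 2, by simpa using hI, fun q hq => ?_⟩
    have hq' : (derivative q).natDegree ≤ n := (natDegree_derivative_le q).trans (by omega)
    have hn : (n + 1 : ℂ) ≠ 0 := by exact_mod_cast n.succ_ne_zero
    have h := ((hγ.hasContourIntegral_deriv_cutWeight_mul ha b
      (q * jacobi n (a + 1) (b + 1))).add ((hi _ hq').const_mul (-1))).const_mul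
        (1 / (2 * (n + 1)))
    convert! h.congr (g := fun z => q.eval z * (jacobi (n + 1) a b).eval z * cutWeight a b z)
      fun t ht => ?_ using 1
    · rw [coeff_derivative]
      field_simp
      ring
    · have hz := hγ.mem_cutPlane ht
      have hJ := congrArg (eval (γ t)) (jacobi_succ n a b)
      simp only [eval_mul, eval_add, eval_sub, eval_X, eval_one, eval_C] at hJ
      rw [cutWeight_add_one_left a (b + 1) hz, cutWeight_add_one_left a b hz,
        cutWeight_add_one_right a b hz]
      simp only [derivative_mul, eval_mul, eval_add]
      push_cast
      field_simp
      linear_combination (eval (γ t) q * cutWeight a b (γ t)) * hJ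

theorem HasContourIntegral.eval_mul_eq_zero {n : ℕ} {f : ℂ → ℂ}
    (hf : ∀ k < n, HasContourIntegral (fun z => z ^ k * f z) γ 0) {q : ℂ[X]}
    (hq : q.natDegree < n) : HasContourIntegral (fun z => q.eval z * f z) γ 0 := by
  have := HasContourIntegral.sum (Finset.range (q.natDegree + 1)) fun k hk =>
    (hf k ((Finset.mem_range_succ_iff.1 hk).trans_lt hq)).const_mul (q.coeff k)
  simp only [mul_zero, Finset.sum_const_zero] at this
  refine this.congr fun t _ => ?_
  rw [eval_eq_sum_range, Finset.sum_mul]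
  exact Finset.sum_congr rfl fun k _ => by ring

/-- The pairing is not positive, so a nonzero remainder `r` of degree `d < n` is tested against the
Jacobi polynomial of degree `d`. The result is zero because that polynomial has degree below `n`,
yet it is also the leading coefficient of `r` times a nonzero constant. -/
theorem IsCurveOne.eq_C_mul_jacobi (hγ : IsCurveOne γ) {n : ℕ} {a b : ℝ} (ha : -1 < a)
    (hb : ∀ j : ℤ, b ≠ j) (hab : ∀ j : ℤ, a + b ≠ j) {p : ℂ[X]} (hp : p.natDegree ≤ n)
    (h : ∀ k < n, HasContourIntegral (fun z => z ^ k * (p.eval z * cutWeight a b z)) γ 0) :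
    ∃ c : ℂ, p = C c * jacobi n a b := by
  refine ⟨p.coeff n / (jacobi n a b).coeff n, ?_⟩
  set c := p.coeff n / (jacobi n a b).coeff n with hc
  by_contra hne
  set r := p - C c * jacobi n a b with hr
  have hr0 : r ≠ 0 := sub_ne_zero.2 hne
  have hrn : r.natDegree ≤ n := (natDegree_sub_le _ _).trans
    (max_le hp ((natDegree_C_mul_le _ _).trans (natDegree_jacobi_le _ _ _)))
  have hrc : r.coeff n = 0 := by
    rw [hr, coeff_sub, coeff_C_mul, hc, div_mul_cancel₀ _ (coeff_jacobi_ne_zero n hab), sub_self]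
  have hd : r.natDegree < n := by
    refine lt_of_le_of_ne hrn fun h0 => hr0 ?_
    rw [← h0] at hrc
    exact leadingCoeff_eq_zero.1 hrc
  obtain ⟨I, -, hI⟩ := hγ.exists_hasContourIntegral_jacobi n ha hb hab
  obtain ⟨K, hK0, hK⟩ := hγ.exists_hasContourIntegral_jacobi r.natDegree ha hb hab
  set q := jacobi r.natDegree (a : ℂ) b with hq
  have hqd : q.natDegree < n := (natDegree_jacobi_le _ _ _).trans_lt hd
  have h1 := HasContourIntegral.eval_mul_eq_zero h hqd
  have h2 := hI q hqd.le
  rw [coeff_eq_zero_of_natDegree_lt hqd, zero_mul] at h2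
  have h3 := (h1.add (h2.const_mul (-c))).congr
    (g := fun z => r.eval z * q.eval z * cutWeight a b z) fun t _ => by
      rw [hr, eval_sub, eval_mul, eval_C]
      ring
  have h4 := (hK r le_rfl).unique h3
  rw [mul_zero, add_zero] at h4
  exact mul_ne_zero (leadingCoeff_ne_zero.2 hr0) hK0 h4

end Jacobi

end

/-! ### Branches of the weight and the theorem at the endpoint `1` -/

noncomputable section

variable {a b : ℝ} {γ : ℝ → ℂ}

/-- Two continuous branches of the weight on a connected set are proportional. -/
theorem IsWeightBranch.exists_eq_const_mul {S : Set ℂ} {W g : ℂ → ℂ} (hS : IsPreconnected S)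
    (hW : IsWeightBranch a b S W) (hg : IsWeightBranch a b S g) :
    ∃ c : ℂ, c ≠ 0 ∧ ∀ z ∈ S, W z = c * g z := by
  have hg0 : ∀ z ∈ S, g z ≠ 0 := fun z hz => by
    obtain ⟨_, _, _, _, h⟩ := hg.2 z hz
    rw [h]
    exact Complex.exp_ne_zero _
  have hcont : ContinuousOn (fun z => W z / g z) S := hW.1.div hg.1 hg0
  -- Logarithms differ by multiples of `2πi`, so the continuous ratio takes countably many values; a
  -- connected set has at most one point in a countable image.
  have hrange : (fun z => W z / g z) '' S ⊆ Set.range fun k : ℤ × ℤ =>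
      Complex.exp (2 * Real.pi * Complex.I * (a * k.1 + b * k.2)) := by
    rintro _ ⟨z, hz, rfl⟩
    obtain ⟨u, v, hu, hv, h⟩ := hW.2 z hz
    obtain ⟨u', v', hu', hv', h'⟩ := hg.2 z hz
    obtain ⟨k, hk⟩ := Complex.exp_eq_exp_iff_exists_int.1 (hu.trans hu'.symm)
    obtain ⟨l, hl⟩ := Complex.exp_eq_exp_iff_exists_int.1 (hv.trans hv'.symm)
    refine ⟨(k, l), ?_⟩
    simp only
    rw [h, h', ← Complex.exp_sub, hk, hl]
    congr 1
    ring
  have hsub := ((Set.countable_range _).mono hrange).isTotallyDisconnected _ Set.Subset.rfl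
    (hS.image _ hcont)
  rcases S.eq_empty_or_nonempty with rfl | ⟨z₀, hz₀⟩
  · exact ⟨1, one_ne_zero, fun z hz => hz.elim⟩
  · refine ⟨W z₀ / g z₀, div_ne_zero ?_ (hg0 z₀ hz₀), fun z hz => ?_⟩
    · obtain ⟨_, _, _, _, h⟩ := hW.2 z₀ hz₀
      rw [h]
      exact Complex.exp_ne_zero _
    · have := hsub (Set.mem_image_of_mem _ hz) (Set.mem_image_of_mem _ hz₀)
      exact (div_eq_iff (hg0 z hz)).1 this

theorem isWeightBranch_cutWeight {S : Set ℂ} (hS : S ⊆ cutPlane) :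
    IsWeightBranch a b S
      (fun z => Complex.exp (b * (Real.pi * Complex.I)) * cutWeight a b z) := by
  refine ⟨continuousOn_const.mul ((continuousOn_cutWeight a b).mono hS), fun z hz => ?_⟩
  have h1 := Complex.slitPlane_ne_zero (one_sub_mem_slitPlane (hS hz))
  have h2 : -(1 + z) ≠ 0 := Complex.slitPlane_ne_zero (hS hz)
  refine ⟨Complex.log (1 - z), Complex.log (-(1 + z)) + Real.pi * Complex.I,
    Complex.exp_log h1, ?_, ?_⟩
  · rw [Complex.exp_add, Complex.exp_log h2, Complex.exp_pi_mul_I]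
    ring
  · simp only
    rw [cutWeight, Complex.cpow_def_of_ne_zero h1, Complex.cpow_def_of_ne_zero h2,
      ← Complex.exp_add, ← Complex.exp_add]
    congr 1
    ring

theorem isWeightBranch_realWeight :
    IsWeightBranch a b (Complex.ofReal '' Set.Ioi 1)
      (fun z => Complex.exp (a * (Real.pi * Complex.I)) * (realWeight a b z.re : ℝ)) := by
  constructor
  · rintro _ ⟨t, ht, rfl⟩
    have ht : 1 < t := ht
    refine ContinuousAt.continuousWithinAt (continuousAt_const.mul ?_)
    refine Complex.continuous_ofReal.continuousAt.comp (f := fun z : ℂ => realWeight a b z.re)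
      (ContinuousAt.mul ?_ ?_)
    · exact ContinuousAt.rpow_const (by fun_prop) (Or.inl (by simp; linarith))
    · exact ContinuousAt.rpow_const (by fun_prop) (Or.inl (by simp; linarith))
  · rintro _ ⟨t, ht, rfl⟩
    have ht : 1 < t := ht
    refine ⟨Real.log (t - 1) + Real.pi * Complex.I, Real.log (t + 1), ?_, ?_, ?_⟩
    · rw [Complex.exp_add, Complex.exp_pi_mul_I, ← Complex.ofReal_exp,
        Real.exp_log (by linarith)]
      push_cast
      ring
    · rw [← Complex.ofReal_exp, Real.exp_log (by linarith)]
      push_cast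
      ring
    · simp only
      rw [Complex.ofReal_re, realWeight, Real.rpow_def_of_pos (by linarith),
        Real.rpow_def_of_pos (by linarith)]
      push_cast
      rw [← Complex.exp_add, ← Complex.exp_add]
      congr 1
      ring

theorem IsCurveOne.exists_branch_eq (hγ : IsCurveOne γ) {W : ℂ → ℂ}
    (hW : IsWeightBranch a b (γ '' Set.Ioo 0 1) W) :
    ∃ c : ℂ, c ≠ 0 ∧ ∀ t ∈ Set.Ioo (0 : ℝ) 1, W (γ t) = c * cutWeight a b (γ t) := by
  have hS : IsPreconnected (γ '' Set.Ioo 0 1) := by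
    refine isPreconnected_Ioo.image _ (hγ.absCont.continuousOn.mono ?_)
    rw [Set.uIcc_of_le zero_le_one]
    exact Set.Ioo_subset_Icc_self
  have hsub : γ '' Set.Ioo 0 1 ⊆ cutPlane := by
    rintro _ ⟨t, ht, rfl⟩
    exact hγ.mem_cutPlane ht
  obtain ⟨c, hc, h⟩ := hW.exists_eq_const_mul hS (isWeightBranch_cutWeight hsub)
  refine ⟨_, mul_ne_zero hc (Complex.exp_ne_zero (b * (Real.pi * Complex.I))), fun t ht => ?_⟩
  rw [h _ (Set.mem_image_of_mem _ ht), mul_assoc]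

theorem exists_realBranch_eq {V : ℂ → ℂ}
    (hV : IsWeightBranch a b (Complex.ofReal '' Set.Ioi 1) V) :
    ∃ c : ℂ, c ≠ 0 ∧ ∀ t : ℝ, 1 < t → V t = c * (realWeight a b t : ℝ) := by
  have hS : IsPreconnected (Complex.ofReal '' Set.Ioi 1) :=
    isPreconnected_Ioi.image _ Complex.continuous_ofReal.continuousOn
  obtain ⟨c, hc, h⟩ := hV.exists_eq_const_mul hS isWeightBranch_realWeight
  refine ⟨_, mul_ne_zero hc (Complex.exp_ne_zero (a * (Real.pi * Complex.I))), fun t ht => ?_⟩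
  rw [h _ (Set.mem_image_of_mem _ ht), mul_assoc, Complex.ofReal_re]

section Main

variable {n : ℕ} {m : ℤ} {V W : ℂ → ℂ}

/-- For `deg q ≤ m` the product `q P_n w` decays fast enough to collapse the curve. Its vanishing
contour integral is the nonzero jump factor times the real integral, so the latter vanishes. -/
theorem multipleOrthogonal_C_mul_jacobi (ha : -1 < a) (hb : ∀ j : ℤ, b ≠ j)
    (hab : ∀ j : ℤ, a + b ≠ j) (hmn : m < n) (hm : a + b + n + m < -1)
    (hV : IsWeightBranch a b (Complex.ofReal '' Set.Ioi 1) V) (hγ : IsCurveOne γ)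
    (hW : IsWeightBranch a b (γ '' Set.Ioo 0 1) W) {c : ℂ} (hc : c ≠ 0) :
    MultipleOrthogonal n m (Set.Ici 1) V γ W (C c * jacobi n a b) := by
  obtain ⟨v, hv, hV⟩ := exists_realBranch_eq hV
  obtain ⟨w, hw, hW⟩ := hγ.exists_branch_eq hW
  obtain ⟨I, hI0, hI⟩ := hγ.exists_hasContourIntegral_jacobi n ha hb hab
  have hcurve : ∀ k ≤ n, HasContourIntegral
      (fun z => z ^ k * (C c * jacobi n a b).eval z * W z) γ
      (w * c * ((X ^ k : ℂ[X]).coeff n * I)) := fun k hk => by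
    refine ((hI (X ^ k) (by simpa using hk)).const_mul (w * c)).congr fun t ht => ?_
    rw [hW t ht]
    simp only [eval_mul, eval_pow, eval_X, eval_C]
    ring
  refine ⟨fun q hq => ?_, fun k _ hk => ?_, ⟨_, ?_, hcurve n le_rfl⟩⟩
  · set s := q * jacobi n a b with hs
    have hsd : a + b + s.natDegree < -1 := by
      have h1 : s.natDegree ≤ q.natDegree + n :=
        natDegree_mul_le.trans (Nat.add_le_add_left (natDegree_jacobi_le n _ _) _)
      have h2 : (s.natDegree : ℝ) ≤ q.natDegree + n := by exact_mod_cast h1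
      have h3 : (q.natDegree : ℝ) ≤ m := by exact_mod_cast hq
      linarith
    have hqn : q.natDegree < n := by exact_mod_cast hq.trans_lt hmn
    have hzero := (hγ.hasContourIntegral_eval_mul_cutWeight_of_lt ha hsd).unique
      ((hI q hqn.le).congr fun t _ => by rw [hs, eval_mul])
    rw [coeff_eq_zero_of_natDegree_lt hqn, zero_mul] at hzero
    have hint := (mul_eq_zero.1 hzero).resolve_left (jumpFactor_ne_zero hab)
    have hcongr : ∀ t ∈ Set.Ioi (1 : ℝ), v * c * (s.eval (t : ℂ) * (realWeight a b t : ℝ)) =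
        q.eval (t : ℂ) * (C c * jacobi n a b).eval (t : ℂ) * V t := fun t ht => by
      rw [hV t ht, hs]
      simp only [eval_mul, eval_C]
      ring
    constructor
    · rw [integrableOn_Ici_iff_integrableOn_Ioi]
      exact IntegrableOn.congr_fun ((integrableOn_eval_mul_realWeight ha hsd).const_mul (v * c))
        hcongr measurableSet_Ioi
    · rw [integral_Ici_eq_integral_Ioi, ← setIntegral_congr_fun measurableSet_Ioi hcongr,
        integral_const_mul, hint, mul_zero]
  · have hk' : k < n := by omega
    have := hcurve k hk'.le
    rwa [coeff_X_pow, if_neg (by omega), zero_mul, mul_zero] at this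
  · rw [coeff_X_pow, if_pos rfl, one_mul]
    exact mul_ne_zero (mul_ne_zero hw hc) hI0

/-- The collapse, read backwards, turns the real conditions for `k ≤ m` into orthogonality on the
curve. With the conditions for `m < k < n` this covers all `k < n`; condition 3 excludes `c = 0`. -/
theorem MultipleOrthogonal.exists_eq_C_mul_jacobi (ha : -1 < a) (hb : ∀ j : ℤ, b ≠ j)
    (hab : ∀ j : ℤ, a + b ≠ j) (hm : a + b + n + m < -1)
    (hV : IsWeightBranch a b (Complex.ofReal '' Set.Ioi 1) V) (hγ : IsCurveOne γ)
    (hW : IsWeightBranch a b (γ '' Set.Ioo 0 1) W) {p : ℂ[X]} (hp : p.natDegree ≤ n)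
    (h : MultipleOrthogonal n m (Set.Ici 1) V γ W p) :
    ∃ c : ℂ, c ≠ 0 ∧ p = C c * jacobi n a b := by
  obtain ⟨v, hv, hV⟩ := exists_realBranch_eq hV
  obtain ⟨w, hw, hW⟩ := hγ.exists_branch_eq hW
  have hzero : ∀ k < n, HasContourIntegral (fun z => z ^ k * (p.eval z * cutWeight a b z)) γ 0 := by
    intro k hk
    rcases le_or_gt (k : ℤ) m with hkm | hkm
    · have hd : a + b + (X ^ k * p).natDegree < -1 := by
        have h1 : (X ^ k * p).natDegree ≤ k + n :=
          natDegree_mul_le.trans (Nat.add_le_add (natDegree_X_pow_le k) hp)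
        have h2 : ((X ^ k * p).natDegree : ℝ) ≤ k + n := by exact_mod_cast h1
        have h3 : (k : ℝ) ≤ m := by exact_mod_cast hkm
        linarith
      have hint := (h.real_line (X ^ k) (by simpa using hkm)).2
      rw [integral_Ici_eq_integral_Ioi, setIntegral_congr_fun
        (g := fun t : ℝ => v * ((X ^ k * p).eval (t : ℂ) * (realWeight a b t : ℝ)))
        measurableSet_Ioi fun t ht => ?_, integral_const_mul] at hint
      · have hc := hγ.hasContourIntegral_eval_mul_cutWeight_of_lt ha hd
        rw [(mul_eq_zero.1 hint).resolve_left hv, mul_zero] at hc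
        refine hc.congr fun t _ => ?_
        rw [eval_mul, eval_pow, eval_X, mul_assoc]
      · simp only
        rw [hV t ht, eval_mul]
        ring
    · have := (h.curve k (by omega) (by omega)).const_mul w⁻¹
      rw [mul_zero] at this
      refine this.congr fun t ht => ?_
      rw [hW t ht]
      field_simp
  obtain ⟨c, rfl⟩ := hγ.eq_C_mul_jacobi ha hb hab hp hzero
  refine ⟨c, ?_, rfl⟩
  rintro rfl
  obtain ⟨I, hI0, hI⟩ := h.curve_ne
  exact hI0 (hI.unique (HasContourIntegral.zero.congr fun t _ => by simp))

end Main

/-! ### Reflection in the origin -/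

section Reflection

theorem IsWeightBranch.comp_neg {S : Set ℂ} {W : ℂ → ℂ} (h : IsWeightBranch a b S W) {T : Set ℂ}
    (hT : ∀ z ∈ T, -z ∈ S) : IsWeightBranch b a T (fun z => W (-z)) := by
  refine ⟨h.1.comp continuous_neg.continuousOn hT, fun z hz => ?_⟩
  obtain ⟨u, v, hu, hv, hW⟩ := h.2 _ (hT z hz)
  refine ⟨v, u, ?_, ?_, ?_⟩
  · rw [hv]
    ring
  · rw [hu]
    ring
  · simp only
    rw [hW, add_comm]

theorem MultipleOrthogonal.comp_neg {n : ℕ} {m : ℤ} {Δ : Set ℝ} {V W : ℂ → ℂ} {p : ℂ[X]}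
    (h : MultipleOrthogonal n m Δ V γ W p) :
    MultipleOrthogonal n m (-Δ) (fun z => V (-z)) (fun t => -γ t) (fun z => W (-z))
      (p.comp (-X)) := by
  have hcurve : ∀ (k : ℕ) (I : ℂ), HasContourIntegral (fun z => z ^ k * p.eval z * W z) γ I →
      HasContourIntegral (fun z => z ^ k * (p.comp (-X)).eval z * W (-z)) (fun t => -γ t)
        ((-1) ^ k * -I) := fun k I hI => by
    refine (hI.comp_neg.const_mul ((-1) ^ k)).congr fun t _ => ?_
    simp only [eval_comp, eval_neg, eval_X, neg_neg]
    rw [neg_pow (γ t) k]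
    ring
  refine ⟨fun q hq => ?_, fun k h1 h2 => ?_, ?_⟩
  · obtain ⟨hi, h0⟩ := h.real_line (q.comp (-X)) (by simpa [natDegree_comp] using hq)
    have hmp := Measure.measurePreserving_neg (volume : Measure ℝ)
    have hemb := (MeasurableEquiv.neg ℝ).measurableEmbedding
    have e : (fun t : ℝ => q.eval (t : ℂ) * (p.comp (-X)).eval (t : ℂ) * V (-t)) =
        (fun t : ℝ => (q.comp (-X)).eval (t : ℂ) * p.eval (t : ℂ) * V t) ∘ Neg.neg := by
      funext t
      simp [eval_comp]
    constructor
    · rw [e]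
      exact (hmp.integrableOn_comp_preimage hemb).2 hi
    · rw [e]
      exact (hmp.setIntegral_preimage_emb hemb _ Δ).trans h0
  · simpa using hcurve k 0 (h.curve k h1 h2)
  · obtain ⟨I, hI0, hI⟩ := h.curve_ne
    exact ⟨_, mul_ne_zero (pow_ne_zero _ (by norm_num)) (neg_ne_zero.2 hI0), hcurve n I hI⟩

/-- Under `z ↦ -z` the factors `z - 1` and `z + 1` swap up to sign, which reverses the sum and
exchanges the parameters. -/
theorem jacobi_comp_neg_X (n : ℕ) (α β : ℂ) :
    (jacobi n α β).comp (-X) = C ((-1) ^ n) * jacobi n β α := by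
  rw [jacobi, jacobi, mul_comp, C_comp, mul_left_comm]
  congr 1
  rw [Polynomial.sum_comp, Finset.mul_sum, ← Finset.sum_range_reflect]
  refine Finset.sum_congr rfl fun k hk => ?_
  obtain ⟨j, rfl⟩ : ∃ j, n = k + j := Nat.exists_eq_add_of_le (Finset.mem_range_succ_iff.1 hk)
  have e1 : k + j + 1 - 1 - k = j := by omega
  have e2 : k + j - j = k := by omega
  have e3 : k + j - k = j := by omega
  rw [e1, e2, e3]
  simp only [mul_comp, C_comp, pow_comp, sub_comp, add_comp, X_comp, one_comp]
  have h1 : (-X - 1 : ℂ[X]) = (-1) * (X + 1) := by ring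
  have h2 : (-X + 1 : ℂ[X]) = (-1) * (X - 1) := by ring
  rw [h1, h2, mul_pow, mul_pow, pow_add]
  simp only [map_mul, map_pow, map_neg, map_one]
  ring

theorem IsCurveNegOne.neg (hγ : IsCurveNegOne γ) : IsCurveOne (fun t => -γ t) where
  absCont := hγ.absCont.neg
  source := by simp [hγ.source]
  target := by simp [hγ.target]
  avoids := by
    rintro t ht ⟨x, hx, hxt⟩
    have hx : -1 ≤ x := hx
    refine hγ.avoids t ht ⟨-x, ?_, ?_⟩
    · show -x ≤ 1
      linarith
    · rw [Complex.ofReal_neg, hxt, neg_neg]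
  starts_below := hγ.starts_above.mono fun t ht => by simpa using ht
  ends_above := hγ.ends_below.mono fun t ht => by simpa using ht

end Reflection

end

end JacobiOrth

/-! ### The theorem at both endpoints -/

theorem theorem6p2 (n : ℕ) (α β : ℝ)
    (hα : ∀ j : ℤ, α ≠ j) (hβ : ∀ j : ℤ, β ≠ j) (hαβ : ∀ j : ℤ, α + β ≠ j)
    (h1 : -(n : ℝ) < α + β + n) (h2 : α + β + n < -1)
    (m : ℤ) (hm : m = ⌊-((n : ℝ) + α + β + 1)⌋) :
    (JacobiOrth.jacobi n α β).natDegree = n ∧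
    (-1 < α →
      ∀ V : ℂ → ℂ, JacobiOrth.IsWeightBranch α β (Complex.ofReal '' Set.Ioi 1) V →
      ∀ γ : ℝ → ℂ, JacobiOrth.IsCurveOne γ →
      ∀ W : ℂ → ℂ, JacobiOrth.IsWeightBranch α β (γ '' Set.Ioo 0 1) W →
        JacobiOrth.MultipleOrthogonal n m (Set.Ici 1) V γ W (JacobiOrth.jacobi n α β) ∧
        ∀ p : Polynomial ℂ, p.natDegree ≤ n →
          (JacobiOrth.MultipleOrthogonal n m (Set.Ici 1) V γ W p ↔
            ∃ c : ℂ, c ≠ 0 ∧ p = Polynomial.C c * JacobiOrth.jacobi n α β)) ∧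
    (-1 < β →
      ∀ V : ℂ → ℂ, JacobiOrth.IsWeightBranch α β (Complex.ofReal '' Set.Iio (-1)) V →
      ∀ γ : ℝ → ℂ, JacobiOrth.IsCurveNegOne γ →
      ∀ W : ℂ → ℂ, JacobiOrth.IsWeightBranch α β (γ '' Set.Ioo 0 1) W →
        JacobiOrth.MultipleOrthogonal n m (Set.Iic (-1)) V γ W (JacobiOrth.jacobi n α β) ∧
        ∀ p : Polynomial ℂ, p.natDegree ≤ n →
          (JacobiOrth.MultipleOrthogonal n m (Set.Iic (-1)) V γ W p ↔
            ∃ c : ℂ, c ≠ 0 ∧ p = Polynomial.C c * JacobiOrth.jacobi n α β)) := by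
  have hmle : (m : ℝ) ≤ -((n : ℝ) + α + β + 1) := by
    rw [hm]
    exact Int.floor_le _
  -- The floor gives only `≤`; equality would make `α + β` an integer. Strictness is what
  -- convergence at infinity needs.
  have hmlt : α + β + n + m < -1 := by
    refine lt_of_le_of_ne (by linarith) fun h => hαβ (-1 - n - m) ?_
    push_cast
    linarith
  have hmn : m < n := by
    have : (m : ℝ) < n := by linarith
    exact_mod_cast this
  have hβα : ∀ j : ℤ, β + α ≠ j := fun j => by
    rw [add_comm]
    exact hαβ j
  have hmlt' : β + α + n + m < -1 := by linarith
  refine ⟨JacobiOrth.natDegree_jacobi n hαβ, fun ha V hV γ hγ W hW => ?_,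
    fun hb V hV γ hγ W hW => ?_⟩
  · have fwd : ∀ c : ℂ, c ≠ 0 → JacobiOrth.MultipleOrthogonal n m (Set.Ici 1) V γ W
        (C c * JacobiOrth.jacobi n α β) := fun c hc =>
      JacobiOrth.multipleOrthogonal_C_mul_jacobi ha hβ hαβ hmn hmlt hV hγ hW hc
    refine ⟨by simpa using fwd 1 one_ne_zero, fun p hp => ⟨fun h => ?_, ?_⟩⟩
    · exact h.exists_eq_C_mul_jacobi ha hβ hαβ hmlt hV hγ hW hp
    · rintro ⟨c, hc, rfl⟩
      exact fwd c hc
  · have hV' : JacobiOrth.IsWeightBranch β α (Complex.ofReal '' Set.Ioi 1) (fun z => V (-z)) := by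
      refine hV.comp_neg ?_
      rintro _ ⟨t, ht, rfl⟩
      have ht : 1 < t := ht
      refine ⟨-t, ?_, by push_cast; rfl⟩
      show -t < -1
      linarith
    have hW' : JacobiOrth.IsWeightBranch β α ((fun t => -γ t) '' Set.Ioo 0 1)
        (fun z => W (-z)) := by
      refine hW.comp_neg ?_
      rintro _ ⟨t, ht, rfl⟩
      exact ⟨t, ht, (neg_neg _).symm⟩
    have hγ' := hγ.neg
    have fwd : ∀ c : ℂ, c ≠ 0 → JacobiOrth.MultipleOrthogonal n m (Set.Iic (-1)) V γ W
        (C c * JacobiOrth.jacobi n α β) := fun c hc => by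
      -- The constant `c * (-1) ^ n` absorbs the sign produced by reflecting the polynomial.
      have h := (JacobiOrth.multipleOrthogonal_C_mul_jacobi hb hα hβα hmn hmlt' hV' hγ' hW'
        (c := c * (-1) ^ n) (mul_ne_zero hc (pow_ne_zero _ (by norm_num)))).comp_neg
      have e : (C (c * (-1) ^ n) * JacobiOrth.jacobi n (β : ℂ) α).comp (-X) =
          C c * JacobiOrth.jacobi n α β := by
        rw [mul_comp, C_comp, JacobiOrth.jacobi_comp_neg_X, ← mul_assoc, ← C_mul, mul_assoc,
          ← mul_pow]
        simp
      rw [e] at h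
      simpa using h
    refine ⟨by simpa using fwd 1 one_ne_zero, fun p hp => ⟨fun h => ?_, ?_⟩⟩
    · have h' := h.comp_neg
      rw [Set.neg_Iic, neg_neg] at h'
      obtain ⟨c, hc, hpc⟩ := h'.exists_eq_C_mul_jacobi hb hα hβα hmlt' hV' hγ' hW'
        (by simpa [natDegree_comp] using hp)
      refine ⟨c * (-1) ^ n, mul_ne_zero hc (pow_ne_zero _ (by norm_num)), ?_⟩
      have := congrArg (fun q => q.comp (-X)) hpc
      simp only [comp_assoc, neg_comp, X_comp, neg_neg, comp_X, mul_comp, C_comp,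
        JacobiOrth.jacobi_comp_neg_X] at this
      rw [this, C_mul, mul_assoc]
    · rintro ⟨c, hc, rfl⟩
      exact fwd c hc
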